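/- For $x\in\mathbb R$ let $\|x\|$ denote the distance from $x$ to the nearest integer. Let $\psi:\{1,2,3,\dots\}\to(0,\infty)$ be a (not necessarily strictly) decreasing function, let $\theta=(\theta_1,\theta_2)\in\mathbb R^2$, and let $1<s<2$. Let $S^\times_2(\psi;\theta)$ be the set of points $(x_1,x_2)\in\mathbb R^2$ such that $$\|qx_1-\theta_1\|\,\|qx_2-\theta_2\|<\psi(q)$$ for infinitely many integers $q\ge 1$. Let $\mathcal H^s$ denote $s$-dimensional Hausdorff measure on the Euclidean plane. Then $$\mathcal H^s\big(S^\times_2(\psi;\theta)\cap[0,1]^2\big)=\begin{cases}0 & \text{if } \sum_{q=1}^\infty q^{2-s}\psi(q)^{s-1}<\infty,\\[1ex] \mathcal H^s([0,1]^2)=\infty & \text{if } \sum_{q=1}^\infty q^{2-s}\psi(q)^{s-1}=\infty.\end{cases}$$ -/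

import Mathlib

open MeasureTheory

noncomputable section

namespace MultApprox

/-- `‖x‖`: the distance from the real number `x` to the nearest integer. -/
def distInt (x : ℝ) : ℝ := |x - round x|

/-- An approximating function: `ψ` is strictly positive and (weakly) decreasing on the positive
integers. The value at `0` plays no role. -/
structure IsApproximatingFunction (ψ : ℕ → ℝ) : Prop where
  pos : ∀ q : ℕ, 1 ≤ q → 0 < ψ q
  antitone : ∀ q r : ℕ, 1 ≤ q → q ≤ r → ψ r ≤ ψ q

/-- The set of inhomogeneously multiplicatively `ψ`-approximable points of `ℝⁿ`: those `x` for
which infinitely many positive integers `q` satisfy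
`‖q x₁ - θ₁‖ ⋯ ‖q xₙ - θₙ‖ < ψ q`. -/
def multApprox (n : ℕ) (ψ : ℕ → ℝ) (θ : EuclideanSpace ℝ (Fin n)) :
    Set (EuclideanSpace ℝ (Fin n)) :=
  {x | {q : ℕ | 1 ≤ q ∧ ∏ i, distInt ((q : ℝ) * x i - θ i) < ψ q}.Infinite}

/-- The unit cube `[0,1]ⁿ` in Euclidean `n`-space. -/
def unitCube (n : ℕ) : Set (EuclideanSpace ℝ (Fin n)) :=
  {x | ∀ i, x i ∈ Set.Icc (0 : ℝ) 1}

end MultApprox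

end

/-!
The index `s = t + 1` with `0 < t < 1` governs the argument. Throughout, the divergence or
convergence of `∑ q ^ (1 - t) * ψ q ^ t = ∑ q * (ψ q / q) ^ t` is what enters.

**Convergence.** For a single `q` the approximable points of the unit square lie in hyperbolic
crosses around about `q ^ 2` shifted rational points. Cutting a cross dyadically into rectangles
and these into squares (`approxAt_subset`, `hausdorffPre_rectangle_le`) gives a cover of cost
`≪ q ^ (1 - t) * ψ q ^ t`, the dyadic sum being geometric because `t < 1`. The Borel-Cantelli lemma
for the outer measures that approximate Hausdorff measure concludes.

**Divergence.** Since `‖q x₂ - θ₂‖ ≤ 1 / 2`, the set contains `W × ℝ`, where `W` is the set of reals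
within `ψ q / q` of shifted fractions `(p + θ₁) / q` for infinitely many `q`. Slicing a cover of
`(W ∩ [a, b]) × [0, 1]` horizontally (`exists_slice_tsum_lt`) reduces a lower bound for its
`s`-dimensional measure to the claim that intervals of total `t`-dimensional cost below
`(b - a) ^ t / 100` cannot cover `W ∩ [a, b]`. As `t < 1`, adding the resulting bound over ever
thinner vertical strips gives infinite measure (`hausdorffMeasure_eq_top_of_strips`).

The claim about `W` is an inhomogeneous Jarník theorem at the critical gauge, proved by a nested
selection (`exists_mem_limsup_of_load_lt`) instead of a Cantor measure. In the selection step
(`exists_load_lt`), an interval `[a, b]` with cheap load contains a ball of radius `ρ k` about a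
shifted fraction whose load is as cheap relative to its own length: otherwise every such ball is
expensive, and one compares with a packing of `[a, b]` by the enlarged balls of radius
`ε * ρ k ^ t`. A cover element is charged for the packing balls smaller than itself, whose total
length it dominates, and for at most one larger ball, which is cheap when `ε` is small. The factor
`ε` may depend on `b - a` because the series diverges whatever the factor, so the constant `1 / 100`
does not deteriorate from step to step.

The packings exist (`exists_packing`) by divergence and local ubiquity
(`exists_isUbiquitous_shiftedFractions`): by Dirichlet's theorem most points of an interval have a
good rational approximation with a denominator of the order of `N`, and then some shifted fraction
with denominator in `(N, 2 N]` lies within `O(N ^ (-2))`.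
-/

open MeasureTheory

noncomputable section

namespace MultApprox

/-! ### Local ubiquity of shifted fractions -/

section

/-- The fractions `(p + θ) / q` with `2 ^ k < q ≤ 2 ^ (k + 1)` and `p` an integer. -/
def shiftedFractions (θ : ℝ) (k : ℕ) : Set ℝ :=
  {y | ∃ q : ℕ, 2 ^ k < q ∧ q ≤ 2 ^ (k + 1) ∧ ∃ p : ℤ, y = (p + θ) / q}

/-- The numerators `q * r.num` run through all residues modulo `r.den` as `q` runs through
`r.den` consecutive integers; picking the residue `⌊r.den * θ⌋` makes `q * r - θ` nearly integral. -/
lemma exists_shifted_fraction_near (θ x : ℝ) (N : ℕ) (hN : 0 < N) (r : ℚ)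
    (hr : |x - r| ≤ 1 / ((N + 1) * r.den)) (hden : r.den ≤ N) (hlarge : N < 8 * r.den) :
    ∃ q : ℕ, N < q ∧ q ≤ 2 * N ∧ ∃ p : ℤ, |x - (p + θ) / q| ≤ 24 / (N : ℝ) ^ 2 := by
  set d := r.den with hd
  have hd0 : 0 < d := r.den_pos
  have hdR : (0 : ℝ) < d := by exact_mod_cast hd0
  have hNR : (0 : ℝ) < N := by exact_mod_cast hN
  set a : ℤ := ⌊(d : ℝ) * θ⌋ with ha
  have hcop : IsCoprime r.num (d : ℤ) := by
    rw [Int.isCoprime_iff_gcd_eq_one]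
    simpa [Int.gcd, Int.natAbs_natCast] using r.reduced
  obtain ⟨u, v, huv⟩ := hcop
  -- the representative of `u * a` modulo `d` in the window `(N, N + d]`
  set e : ℤ := (u * a - (N + 1)) % d with he
  have he0 : 0 ≤ e := Int.emod_nonneg _ (by positivity)
  have he1 : e < d := Int.emod_lt_of_pos _ (by positivity)
  obtain ⟨q, hq⟩ : ∃ q : ℕ, (q : ℤ) = N + 1 + e := ⟨(N + 1 + e).toNat, by omega⟩
  obtain ⟨p, hp⟩ : ∃ p : ℤ, (q : ℤ) * r.num = a + p * d := by
    have h1 : (d : ℤ) * ((u * a - (N + 1)) / d) + e = u * a - (N + 1) :=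
      Int.mul_ediv_add_emod _ _
    refine ⟨- v * a - ((u * a - (N + 1)) / d) * r.num, ?_⟩
    have h2 : (q : ℤ) = u * a - d * ((u * a - (N + 1)) / d) := by rw [hq]; linarith
    rw [h2]
    linear_combination a * huv
  have hqN : N < q := by omega
  have hq2 : q ≤ 2 * N := by omega
  have hqR : (0 : ℝ) < q := by exact_mod_cast (by omega : 0 < q)
  refine ⟨q, hqN, hq2, p, ?_⟩
  have hrR : (r : ℝ) = r.num / d := by exact_mod_cast (Rat.cast_def (K := ℝ) r)
  have hpR : (q : ℝ) * r.num = a + p * d := by exact_mod_cast hp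
  have key : x - (p + θ) / q = (x - r) + (a - d * θ) / (d * q) := by
    rw [hrR]
    field_simp
    linear_combination hpR
  have h3 : |((a : ℝ) - d * θ) / (d * q)| ≤ 1 / (d * q) := by
    rw [abs_div, abs_of_pos (mul_pos hdR hqR)]
    gcongr
    rw [abs_le]
    constructor
    · linarith [Int.lt_floor_add_one ((d : ℝ) * θ)]
    · linarith [Int.floor_le ((d : ℝ) * θ)]
  have h4 : 1 / ((d : ℝ) * q) ≤ 8 / (N : ℝ) ^ 2 := by
    rw [div_le_div_iff₀ (by positivity) (by positivity)]
    have : (N : ℝ) ≤ 8 * d := by exact_mod_cast hlarge.le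
    have : (N : ℝ) ≤ q := by exact_mod_cast hqN.le
    nlinarith
  have h5 : 1 / (((N : ℝ) + 1) * d) ≤ 8 / (N : ℝ) ^ 2 := by
    rw [div_le_div_iff₀ (by positivity) (by positivity)]
    have : (N : ℝ) ≤ 8 * d := by exact_mod_cast hlarge.le
    nlinarith
  rw [key]
  calc _ ≤ |x - r| + |((a : ℝ) - d * θ) / (d * q)| := abs_add_le _ _
    _ ≤ 8 / (N : ℝ) ^ 2 + 8 / (N : ℝ) ^ 2 := by linarith
    _ ≤ 24 / (N : ℝ) ^ 2 := by rw [← add_div]; gcongr; norm_num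

/-- Points of `[a, b]` too close to a fraction of denominator at most `N / 8`. -/
def nearSmallDenominator (a b : ℝ) (N : ℕ) : Set ℝ :=
  {x | x ∈ Set.Icc a b ∧ ∃ r : ℚ, 8 * r.den ≤ N ∧ |x - r| ≤ 1 / ((N + 1) * r.den)}

lemma volume_nearSmallDenominator_le (a b : ℝ) (hab : a < b) (N : ℕ) (hN : 0 < N) :
    volume (nearSmallDenominator a b N) ≤ ENNReal.ofReal
      ((b - a) / 4 + 6 * ((N : ℝ)⁻¹ * ∑ i ∈ Finset.range N, 1 / ((i : ℝ) + 1))) := by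
  have hNR : (0 : ℝ) < N := by exact_mod_cast hN
  set P : ℕ → Finset ℤ := fun i =>
    Finset.Icc ⌈((i : ℝ) + 1) * a - 1⌉ ⌊((i : ℝ) + 1) * b + 1⌋ with hP
  have hsub : nearSmallDenominator a b N ⊆ ⋃ i ∈ Finset.range (N / 8), ⋃ p ∈ P i,
      Metric.closedBall ((p : ℝ) / (i + 1)) (1 / (N * ((i : ℝ) + 1))) := by
    rintro x ⟨⟨hxa, hxb⟩, r, hr8, hr⟩
    have hd0 : 0 < r.den := r.den_pos
    obtain ⟨i, hi⟩ : ∃ i, r.den = i + 1 := ⟨r.den - 1, by omega⟩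
    have hiR : (r.den : ℝ) = i + 1 := by exact_mod_cast hi
    have hrR : (r : ℝ) = r.num / (i + 1) := by rw [← hiR]; exact_mod_cast (Rat.cast_def (K := ℝ) r)
    have hi0 : (0 : ℝ) < (i : ℝ) + 1 := by positivity
    have hr' : |x - r| ≤ 1 / (N * ((i : ℝ) + 1)) := by
      refine hr.trans ?_
      rw [hiR]
      gcongr
      linarith
    have h1 : |((i : ℝ) + 1) * x - r.num| ≤ 1 := by
      have : ((i : ℝ) + 1) * x - r.num = ((i : ℝ) + 1) * (x - r) := by rw [hrR]; field_simp
      rw [this, abs_mul, abs_of_pos hi0]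
      calc _ ≤ ((i : ℝ) + 1) * (1 / (N * ((i : ℝ) + 1))) := by gcongr
        _ = 1 / N := by field_simp
        _ ≤ 1 := by rw [div_le_one hNR]; exact_mod_cast hN
    rw [abs_le] at h1
    simp only [Set.mem_iUnion, hP, Finset.mem_Icc, Finset.mem_range, exists_prop]
    refine ⟨i, by omega, r.num, ⟨Int.ceil_le.2 ?_, Int.le_floor.2 ?_⟩, ?_⟩
    · nlinarith [mul_le_mul_of_nonneg_left hxa hi0.le]
    · nlinarith [mul_le_mul_of_nonneg_left hxb hi0.le]
    · rw [Metric.mem_closedBall, Real.dist_eq, ← hrR]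
      exact hr'
  have hcard : ∀ i, ((P i).card : ℝ) ≤ (i + 1) * (b - a) + 3 := by
    intro i
    rw [hP, Int.card_Icc]
    have h1 := Int.floor_le (((i : ℝ) + 1) * b + 1)
    have h2 := Int.le_ceil (((i : ℝ) + 1) * a - 1)
    have h3 : ((⌊((i : ℝ) + 1) * b + 1⌋ + 1 - ⌈((i : ℝ) + 1) * a - 1⌉).toNat : ℝ)
        = ((max (⌊((i : ℝ) + 1) * b + 1⌋ + 1 - ⌈((i : ℝ) + 1) * a - 1⌉) 0 : ℤ) : ℝ) := by
      rw [← Int.toNat_eq_max, Int.cast_natCast]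
    rw [h3]
    push_cast
    refine max_le (by linarith) ?_
    have : 0 < ((i : ℝ) + 1) * (b - a) := mul_pos (by positivity) (by linarith)
    linarith
  calc volume (nearSmallDenominator a b N)
      ≤ ∑ i ∈ Finset.range (N / 8), ∑ p ∈ P i,
        volume (Metric.closedBall ((p : ℝ) / (i + 1)) (1 / (N * ((i : ℝ) + 1)))) := by
        refine (measure_mono hsub).trans ((measure_biUnion_finset_le _ _).trans ?_)
        exact Finset.sum_le_sum fun i _ => measure_biUnion_finset_le _ _
    _ = ENNReal.ofReal (∑ i ∈ Finset.range (N / 8), (P i).card * (2 * (1 / (N * ((i : ℝ) + 1))))) := by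
        rw [ENNReal.ofReal_sum_of_nonneg (fun i _ => by positivity)]
        refine Finset.sum_congr rfl fun i _ => ?_
        simp only [Real.volume_closedBall, Finset.sum_const, nsmul_eq_mul]
        rw [ENNReal.ofReal_mul (Nat.cast_nonneg _), ENNReal.ofReal_natCast]
    _ ≤ _ := by
        apply ENNReal.ofReal_le_ofReal
        calc ∑ i ∈ Finset.range (N / 8), (P i).card * (2 * (1 / (N * ((i : ℝ) + 1))))
            ≤ ∑ i ∈ Finset.range (N / 8),
              (2 * (b - a) / N + 6 * ((N : ℝ)⁻¹ * (1 / ((i : ℝ) + 1)))) := by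
              refine Finset.sum_le_sum fun i _ => ?_
              calc _ ≤ (((i : ℝ) + 1) * (b - a) + 3) * (2 * (1 / (N * ((i : ℝ) + 1)))) := by
                    gcongr; exact hcard i
                _ = _ := by field_simp; ring
          _ = ((N / 8 : ℕ) : ℝ) * (2 * (b - a) / N) +
              6 * ((N : ℝ)⁻¹ * ∑ i ∈ Finset.range (N / 8), 1 / ((i : ℝ) + 1)) := by
              rw [Finset.sum_add_distrib, Finset.sum_const, Finset.card_range, nsmul_eq_mul,
                ← Finset.mul_sum, ← Finset.mul_sum]
          _ ≤ _ := by
              gcongr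
              · have : ((N / 8 : ℕ) : ℝ) ≤ N / 8 := by
                  simpa using (Nat.cast_div_le (α := ℝ) (m := N) (n := 8))
                calc ((N / 8 : ℕ) : ℝ) * (2 * (b - a) / N) ≤ (N / 8) * (2 * (b - a) / N) := by
                      have : 0 ≤ b - a := by linarith
                      gcongr
                  _ = _ := by field_simp; ring
              · exact Nat.div_le_self _ _

/-- Local ubiquity of the sets `X k` in `[a, b]` from level `k₀` on: the points of `[a, b]` within
`24 / 4 ^ k` of `X k` make up at least half of `[a, b]`. This is phrased as the impossibility of
avoiding them by removing a set of smaller measure, so that no measurability is involved. -/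
def IsUbiquitous (X : ℕ → Set ℝ) (a b : ℝ) (k₀ : ℕ) : Prop :=
  ∀ k ≥ k₀, ∀ Z : Set ℝ, volume Z < ENNReal.ofReal ((b - a) / 2) →
    ∃ x ∈ Set.Icc a b, x ∉ Z ∧ ∃ y ∈ X k, |x - y| ≤ 24 * (4 ^ k)⁻¹

lemma exists_isUbiquitous_shiftedFractions (θ a b : ℝ) (hab : a < b) :
    ∃ k₀ : ℕ, IsUbiquitous (shiftedFractions θ) a b k₀ := by
  have hces := (tendsto_one_div_add_atTop_nhds_zero_nat (𝕜 := ℝ)).cesaro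
  have hev : ∀ᶠ N : ℕ in Filter.atTop,
      (N : ℝ)⁻¹ * ∑ i ∈ Finset.range N, 1 / ((i : ℝ) + 1) < (b - a) / 24 :=
    hces.eventually_lt_const (by linarith)
  obtain ⟨N₀, hN₀⟩ := Filter.eventually_atTop.1 hev
  refine ⟨N₀, fun k hk Z hZ => ?_⟩
  have hN : 0 < 2 ^ k := by positivity
  have hbig : N₀ ≤ 2 ^ k := hk.trans Nat.lt_two_pow_self.le
  have hvol := volume_nearSmallDenominator_le a b hab (2 ^ k) hN
  have hsmall := hN₀ _ hbig
  have hlt : volume (Z ∪ nearSmallDenominator a b (2 ^ k)) < volume (Set.Icc a b) := by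
    rw [Real.volume_Icc]
    calc _ ≤ volume Z + volume (nearSmallDenominator a b (2 ^ k)) := measure_union_le _ _
      _ < ENNReal.ofReal ((b - a) / 2) + ENNReal.ofReal ((b - a) / 2) := by
          refine ENNReal.add_lt_add_of_lt_of_le ?_ hZ (hvol.trans ?_)
          · exact ne_top_of_le_ne_top ENNReal.ofReal_ne_top hvol
          · apply ENNReal.ofReal_le_ofReal
            linarith
      _ = _ := by rw [← ENNReal.ofReal_add (by linarith) (by linarith)]; congr 1; ring
  obtain ⟨x, hx, hxn⟩ : ∃ x ∈ Set.Icc a b, x ∉ Z ∪ nearSmallDenominator a b (2 ^ k) := by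
    by_contra! h
    exact absurd (measure_mono (μ := volume) h) (not_le.2 hlt)
  rw [Set.mem_union, not_or] at hxn
  obtain ⟨r, hr, hrd⟩ := Real.exists_rat_abs_sub_le_and_den_le x hN
  have hlarge : 2 ^ k < 8 * r.den := by
    by_contra h
    exact hxn.2 ⟨hx, r, by omega, by exact_mod_cast hr⟩
  obtain ⟨q, hq1, hq2, p, hp⟩ :=
    exists_shifted_fraction_near θ x (2 ^ k) hN r (by exact_mod_cast hr) hrd hlarge
  refine ⟨x, hx, hxn.1, _, ⟨q, hq1, by rw [pow_succ]; omega, p, rfl⟩, hp.trans (le_of_eq ?_)⟩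
  push_cast
  rw [← pow_mul, mul_comm k 2, pow_mul, div_eq_mul_inv]
  norm_num

end

/-! ### Packings by balls around a ubiquitous system -/

section

/-- A finite family `F` of balls inside `[a, b]`, recorded as pairs (level, centre): the ball at
`(k, y)` has centre `y ∈ X k` and radius `σ k`. The levels are at least `k₁`, and distinct balls
are disjoint. -/
structure IsPacking (X : ℕ → Set ℝ) (σ : ℕ → ℝ) (a b : ℝ) (k₁ : ℕ) (F : Finset (ℕ × ℝ)) :
    Prop where
  level_le : ∀ i ∈ F, k₁ ≤ i.1
  mem : ∀ i ∈ F, i.2 ∈ X i.1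
  left_le : ∀ i ∈ F, a ≤ i.2 - σ i.1
  le_right : ∀ i ∈ F, i.2 + σ i.1 ≤ b
  separated : ∀ i ∈ F, ∀ j ∈ F, i ≠ j → σ i.1 + σ j.1 < |i.2 - j.2|

variable {X : ℕ → Set ℝ} {σ : ℕ → ℝ} {a b : ℝ} {k₀ k₁ : ℕ} {F : Finset (ℕ × ℝ)}

/-- As long as a packing has small total length and not too many members, a ball of level `k`
can be added: the points it has to avoid do not fill half of `[a, b]`. -/
lemma IsPacking.exists_insert (hF : IsPacking X σ a b k₁ F) (hσ : ∀ k, 0 < σ k)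
    (hσ4 : ∀ k, σ k ≤ (4 ^ k)⁻¹) (hX : IsUbiquitous X a b k₀) (hab : a < b) {k : ℕ}
    (hk₀ : k₀ ≤ k) (hk₁ : k₁ ≤ k) (hsum : ∑ i ∈ F, σ i.1 < (b - a) / 16)
    (hcard : ((F.card : ℝ) + 2) ≤ (b - a) * 4 ^ k / 200) :
    ∃ y, (k, y) ∉ F ∧ IsPacking X σ a b k₁ (insert (k, y) F) := by
  have h4 : (0 : ℝ) < 4 ^ k := by positivity
  set δ : ℝ := 24 * (4 ^ k)⁻¹ + σ k with hδ
  have hδ0 : 0 < δ := by have := hσ k; positivity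
  have hδ25 : δ ≤ 25 * (4 ^ k)⁻¹ := by linarith [hσ4 k]
  set Z : Set ℝ := (⋃ i ∈ F, Metric.closedBall i.2 (δ + σ i.1)) ∪
    (Metric.closedBall a δ ∪ Metric.closedBall b δ) with hZ
  have hvol : volume Z < ENNReal.ofReal ((b - a) / 2) := by
    calc volume Z ≤ ∑ i ∈ F, ENNReal.ofReal (2 * (δ + σ i.1)) +
          (ENNReal.ofReal (2 * δ) + ENNReal.ofReal (2 * δ)) := by
          refine (measure_union_le _ _).trans (add_le_add ?_ ?_)
          · refine (measure_biUnion_finset_le _ _).trans (le_of_eq ?_)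
            simp [Real.volume_closedBall]
          · refine (measure_union_le _ _).trans (le_of_eq ?_)
            simp [Real.volume_closedBall]
      _ = ENNReal.ofReal (2 * δ * (F.card + 2) + 2 * ∑ i ∈ F, σ i.1) := by
          rw [← ENNReal.ofReal_sum_of_nonneg (fun i _ => by have := hσ i.1; positivity),
            ← ENNReal.ofReal_add (by positivity) (by positivity),
            ← ENNReal.ofReal_add
              (Finset.sum_nonneg fun i _ => by have := hσ i.1; positivity) (by positivity)]
          congr 1
          rw [← Finset.mul_sum, Finset.sum_add_distrib, Finset.sum_const, nsmul_eq_mul]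
          ring
      _ < _ := by
          rw [ENNReal.ofReal_lt_ofReal_iff (by linarith)]
          have : 2 * δ * (F.card + 2) ≤ 2 * (25 * (4 ^ k)⁻¹) * ((b - a) * 4 ^ k / 200) := by
            gcongr
          have h2 : 2 * (25 * (4 ^ k)⁻¹) * ((b - a) * 4 ^ k / 200) = (b - a) / 4 := by
            field_simp; ring
          linarith
  obtain ⟨x, hx, hxZ, y, hy, hxy⟩ := hX k hk₀ Z hvol
  simp only [hZ, Set.mem_union, Set.mem_iUnion, Metric.mem_closedBall, Real.dist_eq, not_or,
    not_exists, not_le] at hxZ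
  obtain ⟨hxF, hxa, hxb⟩ := hxZ
  have hsep : ∀ i ∈ F, σ k + σ i.1 < |y - i.2| := by
    intro i hi
    have h1 := hxF i hi
    have h2 := abs_sub_le x y i.2
    linarith
  have hya : a ≤ y - σ k := by
    rw [abs_of_nonneg (by linarith [hx.1])] at hxa
    linarith [(abs_le.1 hxy).2]
  have hyb : y + σ k ≤ b := by
    rw [abs_of_nonpos (by linarith [hx.2])] at hxb
    linarith [(abs_le.1 hxy).1]
  refine ⟨y, fun hmem => ?_, ⟨?_, ?_, ?_, ?_, ?_⟩⟩
  · have := hsep _ hmem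
    simp only [sub_self, abs_zero] at this
    linarith [hσ k]
  · simpa [Finset.forall_mem_insert] using ⟨hk₁, fun n z h => hF.level_le _ h⟩
  · simpa [Finset.forall_mem_insert] using ⟨hy, fun n z h => hF.mem _ h⟩
  · intro i hi
    rcases Finset.mem_insert.1 hi with rfl | hi
    exacts [hya, hF.left_le i hi]
  · intro i hi
    rcases Finset.mem_insert.1 hi with rfl | hi
    exacts [hyb, hF.le_right i hi]
  · intro i hi j hj hij
    rcases Finset.mem_insert.1 hi with rfl | hi <;> rcases Finset.mem_insert.1 hj with rfl | hj
    · exact absurd rfl hij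
    · exact hsep j hj
    · rw [add_comm, abs_sub_comm]; exact hsep i hi
    · exact hF.separated i hi j hj hij

lemma IsPacking.exists_add_level (hF : IsPacking X σ a b k₁ F) (hσ : ∀ k, 0 < σ k)
    (hσ4 : ∀ k, σ k ≤ (4 ^ k)⁻¹) (hX : IsUbiquitous X a b k₀) (hab : a < b) {k : ℕ}
    (hk₀ : k₀ ≤ k) (hk₁ : k₁ ≤ k) (m : ℕ)
    (hcard : ((F.card : ℝ) + m + 2) ≤ (b - a) * 4 ^ k / 200) :
    ∃ F', IsPacking X σ a b k₁ F' ∧ F'.card ≤ F.card + m ∧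
      ((b - a) / 16 ≤ ∑ i ∈ F', σ i.1 ∨ ∑ i ∈ F, σ i.1 + m * σ k ≤ ∑ i ∈ F', σ i.1) := by
  induction m with
  | zero => exact ⟨F, hF, by simp, Or.inr (by simp)⟩
  | succ m ih =>
    push_cast at hcard
    obtain ⟨F', hF', hc, h⟩ := ih (by linarith)
    by_cases hs : (b - a) / 16 ≤ ∑ i ∈ F', σ i.1
    · exact ⟨F', hF', by omega, Or.inl hs⟩
    · have hcR : (F'.card : ℝ) ≤ F.card + m := by exact_mod_cast hc
      obtain ⟨y, hy, hins⟩ := hF'.exists_insert hσ hσ4 hX hab hk₀ hk₁ (not_le.1 hs)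
        (by linarith)
      refine ⟨_, hins, by rw [Finset.card_insert_of_notMem hy]; omega, Or.inr ?_⟩
      rw [Finset.sum_insert hy]
      push_cast
      linarith [h.resolve_left hs]

/-- If `∑ 4 ^ k * σ k` diverges, then a ubiquitous system carries packings by balls of radii
`σ k` of arbitrarily high level, filling a fixed proportion of `[a, b]`. -/
lemma exists_packing (hσ : ∀ k, 0 < σ k) (hσ4 : ∀ k, σ k ≤ (4 ^ k)⁻¹)
    (hdiv : ¬ Summable fun k => (4 : ℝ) ^ k * σ k) (hX : IsUbiquitous X a b k₀) (hab : a < b)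
    (k₁ : ℕ) : ∃ F, IsPacking X σ a b k₁ F ∧ (b - a) / 16 ≤ ∑ i ∈ F, σ i.1 := by
  -- Level `k` contributes `⌊β * 4 ^ k⌋` balls. With those of the lower levels there are at most
  -- `2 * β * 4 ^ k` balls at any time, few enough for another one to fit.
  set β : ℝ := (b - a) / 800 with hβ
  have hβ0 : 0 < β := by rw [hβ]; linarith
  obtain ⟨k₂, hk₂⟩ : ∃ k₂ : ℕ, 1 ≤ β * 4 ^ k₂ := by
    obtain ⟨n, hn⟩ := pow_unbounded_of_one_lt (1 / β) (by norm_num : (1 : ℝ) < 4)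
    exact ⟨n, by rw [div_lt_iff₀ hβ0] at hn; linarith⟩
  set K := max (max k₀ k₁) k₂ with hK
  have step : ∀ n : ℕ, ∃ F, IsPacking X σ a b k₁ F ∧ (F.card : ℝ) ≤ β * 4 ^ (K + n) ∧
      ((b - a) / 16 ≤ ∑ i ∈ F, σ i.1 ∨
        β / 2 * ∑ j ∈ Finset.range n, 4 ^ (K + j) * σ (K + j) ≤ ∑ i ∈ F, σ i.1) := by
    intro n
    induction n with
    | zero => exact ⟨∅, ⟨by simp, by simp, by simp, by simp, by simp⟩,
        by simpa using (by positivity), Or.inr (by simp)⟩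
    | succ n ih =>
      obtain ⟨F, hF, hc, h⟩ := ih
      have h1 : 1 ≤ β * 4 ^ (K + n) := by
        refine hk₂.trans ?_
        gcongr
        · norm_num
        · omega
      set m := ⌊β * 4 ^ (K + n)⌋₊ with hm
      have hm1 : (m : ℝ) ≤ β * 4 ^ (K + n) := Nat.floor_le (by positivity)
      have hm2 : β * 4 ^ (K + n) < m + 1 := Nat.lt_floor_add_one _
      have hm3 : (1 : ℝ) ≤ m := Nat.one_le_cast.2 ((Nat.one_le_floor_iff _).2 h1)
      have h200 : (b - a) * 4 ^ (K + n) / 200 = 4 * (β * 4 ^ (K + n)) := by rw [hβ]; ring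
      obtain ⟨F', hF', hc', h'⟩ := hF.exists_add_level hσ hσ4 hX hab (k := K + n) (by omega)
        (by omega) m (by rw [h200]; linarith)
      have hcR : (F'.card : ℝ) ≤ F.card + m := by exact_mod_cast hc'
      have h4 : (4 : ℝ) ^ (K + (n + 1)) = 4 * 4 ^ (K + n) := by rw [← add_assoc, pow_succ]; ring
      refine ⟨F', hF', by rw [h4]; linarith, ?_⟩
      rcases h' with h' | h'
      · exact Or.inl h'
      have hmσ : 0 ≤ (m : ℝ) * σ (K + n) := by have := hσ (K + n); positivity
      rcases h with h | h
      · exact Or.inl (by linarith)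
      · refine Or.inr ?_
        rw [Finset.sum_range_succ, mul_add]
        have : β / 2 * (4 ^ (K + n) * σ (K + n)) ≤ m * σ (K + n) := by
          rw [← mul_assoc]
          exact mul_le_mul_of_nonneg_right (by linarith) (hσ _).le
        linarith
  have hdiv' : ¬ Summable fun j => (4 : ℝ) ^ (K + j) * σ (K + j) := by
    intro h
    refine hdiv ((summable_nat_add_iff K).1 ?_)
    simpa only [add_comm] using h
  have htend := (not_summable_iff_tendsto_nat_atTop_of_nonneg
    (fun j => by have := hσ (K + j); positivity)).1 hdiv'
  obtain ⟨n, hn⟩ := (htend.eventually_ge_atTop ((b - a) / 16 / (β / 2))).exists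
  obtain ⟨F, hF, -, h | h⟩ := step n
  · exact ⟨F, hF, h⟩
  · refine ⟨F, hF, le_trans ?_ h⟩
    rwa [div_le_iff₀' (by positivity)] at hn

end

/-! ### Cost of a cover and the selection step -/

section

open Classical in
/-- The total `t`-dimensional cost of those intervals `[x j - d j, x j + d j]` that meet
`[a, b]`. -/
def load {ι : Type*} (x d : ι → ℝ) (t a b : ℝ) : ENNReal :=
  ∑' j, if (Metric.closedBall (x j) (d j) ∩ Set.Icc a b).Nonempty then
    ENNReal.ofReal (d j ^ t) else 0

variable {X : ℕ → Set ℝ} {σ : ℕ → ℝ} {a b : ℝ} {k₀ k₁ : ℕ} {F : Finset (ℕ × ℝ)}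
  {ι : Type*} {x d : ι → ℝ} {t : ℝ}

lemma le_load {j : ι} (hj : (Metric.closedBall (x j) (d j) ∩ Set.Icc a b).Nonempty) :
    ENNReal.ofReal (d j ^ t) ≤ load x d t a b := by
  classical
  refine le_trans (le_of_eq ?_) (ENNReal.le_tsum j)
  rw [if_pos hj]

lemma IsPacking.sum_le_of_subset_closedBall (hF : IsPacking X σ a b k₁ F) (hσ : ∀ k, 0 < σ k)
    {G : Finset (ℕ × ℝ)} (hG : G ⊆ F) {u r : ℝ} (hr : 0 ≤ r)
    (h : ∀ i ∈ G, Metric.closedBall i.2 (σ i.1) ⊆ Metric.closedBall u r) :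
    ∑ i ∈ G, σ i.1 ≤ r := by
  have hdisj : (G : Set (ℕ × ℝ)).PairwiseDisjoint fun i => Metric.closedBall i.2 (σ i.1) := by
    intro i hi j hj hij
    refine Metric.closedBall_disjoint_closedBall ?_
    rw [Real.dist_eq]
    exact hF.separated i (hG hi) j (hG hj) hij
  have h1 : ∑ i ∈ G, volume (Metric.closedBall i.2 (σ i.1)) ≤ volume (Metric.closedBall u r) := by
    rw [← measure_biUnion_finset hdisj fun i _ => measurableSet_closedBall]
    exact measure_mono (Set.iUnion₂_subset h)
  simp only [Real.volume_closedBall] at h1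
  rw [← ENNReal.ofReal_sum_of_nonneg (fun i _ => by have := hσ i.1; positivity),
    ENNReal.ofReal_le_ofReal_iff (by positivity), ← Finset.mul_sum] at h1
  linarith

/-- One cover element interacts with the packing in a controlled way: the packing balls of radius at
most twice its own and near it have total length comparable to it, and at most one larger
packing ball has its core (of at most half the radius) near it. -/
lemma IsPacking.sum_interaction_le (hF : IsPacking X σ a b k₁ F) (hσ : ∀ k, 0 < σ k)
    {ρ : ℕ → ℝ} (hρσ : ∀ i ∈ F, ρ i.1 ≤ σ i.1 / 2) {u r v : ℝ} (hr : 0 < r)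
    (hv : 0 ≤ v) (G : Finset (ℕ × ℝ)) (hG : G ⊆ F)
    (hmeet : ∀ i ∈ G, (Metric.closedBall u r ∩ Set.Icc (i.2 - ρ i.1) (i.2 + ρ i.1)).Nonempty) :
    ∑ i ∈ G, (if σ i.1 ≤ 2 * r then σ i.1 else v) ≤ 4 * r + v := by
  have hclose : ∀ i ∈ G, |i.2 - u| ≤ r + σ i.1 / 2 := by
    intro i hi
    obtain ⟨z, hz1, hz2, hz3⟩ := hmeet i hi
    rw [Metric.mem_closedBall, Real.dist_eq, abs_le] at hz1
    have := hρσ i (hG hi)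
    rw [abs_le]
    constructor <;> linarith
  rw [Finset.sum_ite]
  refine add_le_add ?_ ?_
  · refine hF.sum_le_of_subset_closedBall hσ ((Finset.filter_subset _ _).trans hG) (u := u)
      (by positivity) fun i hi => ?_
    rw [Finset.mem_filter] at hi
    refine Metric.closedBall_subset_closedBall' ?_
    rw [Real.dist_eq]
    linarith [hclose i hi.1]
  · rw [Finset.sum_const, nsmul_eq_mul]
    have hcard : (G.filter fun i => ¬ σ i.1 ≤ 2 * r).card ≤ 1 := by
      refine Finset.card_le_one.2 fun i hi j hj => ?_
      rw [Finset.mem_filter, not_le] at hi hj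
      by_contra hij
      have h1 := hF.separated i (hG hi.1) j (hG hj.1) hij
      have h2 := hclose i hi.1
      have h3 := hclose j hj.1
      have h4 := abs_sub_le i.2 u j.2
      rw [abs_sub_comm u] at h4
      linarith [hi.2, hj.2]
    have : ((G.filter fun i => ¬ σ i.1 ≤ 2 * r).card : ℝ) ≤ 1 := by exact_mod_cast hcard
    nlinarith

lemma eventually_le_mul_rpow {ρ : ℕ → ℝ} {ε : ℝ} (ht0 : 0 < t) (ht1 : t < 1)
    (hρ : ∀ k, 0 < ρ k) (hρ4 : ∀ k, ρ k ^ t ≤ (4 ^ k)⁻¹) (hε : 0 < ε) :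
    ∀ᶠ k in Filter.atTop, ρ k ≤ ε * ρ k ^ t := by
  have hp : 0 < (1 - t) / t := div_pos (by linarith) ht0
  have h4 : Filter.Tendsto (fun k : ℕ => ((4 : ℝ) ^ k)⁻¹) Filter.atTop (nhds 0) := by
    simpa [inv_pow] using tendsto_pow_atTop_nhds_zero_of_lt_one (r := (4 : ℝ)⁻¹) (by norm_num)
      (by norm_num)
  have h5 := h4.rpow_const (p := (1 - t) / t) (Or.inr hp.le)
  rw [Real.zero_rpow hp.ne'] at h5
  filter_upwards [h5.eventually_le_const hε] with k hk
  have h6 : ρ k ^ (1 - t) ≤ ε := by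
    refine le_trans ?_ hk
    calc ρ k ^ (1 - t) = (ρ k ^ t) ^ ((1 - t) / t) := by
          rw [← Real.rpow_mul (hρ k).le]; congr 1; field_simp
      _ ≤ _ := by
          have := hρ k
          exact Real.rpow_le_rpow (by positivity) (hρ4 k) hp.le
  calc ρ k = ρ k ^ (1 - t) * ρ k ^ t := by
        rw [← Real.rpow_add (hρ k)]; simp
    _ ≤ _ := by have := hρ k; gcongr

/-- The selection step. If a family of intervals has cost less than `(b - a) ^ t / 100` on
`[a, b]`, then the same holds relative to some ball of radius `ρ k` around a point of `X k`,
with `k` as large as desired. Otherwise every ball of radius `ρ k` is expensive; take a packing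
by the much larger balls of radii `ε * ρ k ^ t`. Their total length is comparable to `b - a`, but
distributing it over the cover elements bounds it by a small multiple of `b - a`. -/
lemma exists_load_lt {ρ : ℕ → ℝ} (ht0 : 0 < t) (ht1 : t < 1) (hd : ∀ j, 0 < d j)
    (hρ : ∀ k, 0 < ρ k) (hρ4 : ∀ k, ρ k ^ t ≤ (4 ^ k)⁻¹)
    (hdiv : ¬ Summable fun k => (4 : ℝ) ^ k * ρ k ^ t) (hX : IsUbiquitous X a b k₀)
    (hab : a < b) (hload : load x d t a b < ENNReal.ofReal ((b - a) ^ t / 100)) (N : ℕ) :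
    ∃ k ≥ N, ∃ y ∈ X k, a ≤ y - ρ k ∧ y + ρ k ≤ b ∧
      load x d t (y - ρ k) (y + ρ k) < ENNReal.ofReal ((2 * ρ k) ^ t / 100) := by
  classical
  by_contra! hcon
  set l := b - a with hl
  have hl0 : 0 < l := by linarith
  have hlt : 0 < l ^ (1 - t) := by positivity
  set ε : ℝ := min 1 (l ^ (1 - t) / 100) with hε
  have hε0 : 0 < ε := by positivity
  have hε1 : ε ≤ 1 := min_le_left _ _
  have hε2 : ε * 100 ≤ l ^ (1 - t) := by
    have := min_le_right 1 (l ^ (1 - t) / 100)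
    linarith
  set σ : ℕ → ℝ := fun k => ε * ρ k ^ t with hσdef
  have hρt : ∀ k, 0 < ρ k ^ t := fun k => by have := hρ k; positivity
  have hσ : ∀ k, 0 < σ k := fun k => mul_pos hε0 (hρt k)
  have hσ4 : ∀ k, σ k ≤ (4 ^ k)⁻¹ := fun k =>
    (mul_le_of_le_one_left (hρt k).le hε1).trans (hρ4 k)
  have hdivσ : ¬ Summable fun k => (4 : ℝ) ^ k * σ k := by
    intro h
    refine hdiv ((summable_mul_left_iff hε0.ne').1 (h.congr fun k => ?_))
    simp only [hσdef]; ring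
  obtain ⟨k₂, hk₂⟩ := Filter.eventually_atTop.1
    (eventually_le_mul_rpow ht0 ht1 hρ hρ4 (half_pos hε0))
  obtain ⟨F, hF, hsum⟩ := exists_packing hσ hσ4 hdivσ hX hab (max N k₂)
  have hρσ : ∀ i ∈ F, ρ i.1 ≤ σ i.1 / 2 := by
    intro i hi
    have := hk₂ i.1 ((le_max_right _ _).trans (hF.level_le i hi))
    simp only [hσdef]
    linarith
  have hsubIcc : ∀ i ∈ F, a ≤ i.2 - ρ i.1 ∧ i.2 + ρ i.1 ≤ b := by
    intro i hi
    have h1 := hF.left_le i hi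
    have h2 := hF.le_right i hi
    have h3 := hρσ i hi
    have h4 := hσ i.1
    constructor <;> linarith
  set M : ℕ × ℝ → ι → Prop := fun i j =>
    (Metric.closedBall (x j) (d j) ∩ Set.Icc (i.2 - ρ i.1) (i.2 + ρ i.1)).Nonempty with hM
  -- the share of the packing ball `i` that is charged to the cover element `j`
  set g : ℕ × ℝ → ι → ENNReal := fun i j =>
    if M i j then ENNReal.ofReal (if σ i.1 ≤ 2 * d j then σ i.1 else 100 * ε * d j ^ t) else 0
    with hg
  have hcharge : ∀ i ∈ F, ENNReal.ofReal (σ i.1) ≤ ∑' j, g i j := by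
    intro i hi
    by_cases hA : ∃ j, M i j ∧ σ i.1 ≤ 2 * d j
    · obtain ⟨j, hj, hj2⟩ := hA
      refine le_trans (le_of_eq ?_) (ENNReal.le_tsum j)
      simp only [hg, if_pos hj, if_pos hj2]
    · push Not at hA
      have h1 : ∑' j, g i j =
          ENNReal.ofReal (100 * ε) * load x d t (i.2 - ρ i.1) (i.2 + ρ i.1) := by
        rw [load, ← ENNReal.tsum_mul_left]
        refine tsum_congr fun j => ?_
        by_cases hj : M i j
        · simp only [hg, if_pos hj, if_neg (not_le.2 (hA j hj))]
          rw [if_pos hj, ENNReal.ofReal_mul (by positivity)]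
        · simp only [hg, if_neg hj]
          rw [if_neg hj, mul_zero]
      have h2 := hcon i.1 ((le_max_left _ _).trans (hF.level_le i hi)) i.2 (hF.mem i hi)
        (hsubIcc i hi).1 (hsubIcc i hi).2
      rw [h1]
      refine le_trans ?_ (mul_le_mul_right h2 _)
      rw [← ENNReal.ofReal_mul (by positivity)]
      apply ENNReal.ofReal_le_ofReal
      have h3 : ρ i.1 ^ t ≤ (2 * ρ i.1) ^ t := by
        have := hρ i.1
        exact Real.rpow_le_rpow this.le (by linarith) ht0.le
      simp only [hσdef]
      nlinarith
  have hcost : ∀ j, ∑ i ∈ F, g i j ≤ ENNReal.ofReal (5 * l ^ (1 - t)) *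
      (if (Metric.closedBall (x j) (d j) ∩ Set.Icc a b).Nonempty then
        ENNReal.ofReal (d j ^ t) else 0) := by
    intro j
    have hdj := hd j
    have h1 : ∑ i ∈ F, g i j = ENNReal.ofReal (∑ i ∈ F.filter fun i => M i j,
        if σ i.1 ≤ 2 * d j then σ i.1 else 100 * ε * d j ^ t) := by
      rw [ENNReal.ofReal_sum_of_nonneg, Finset.sum_filter]
      intro i _
      have := hσ i.1
      split_ifs <;> positivity
    by_cases hj : (Metric.closedBall (x j) (d j) ∩ Set.Icc a b).Nonempty
    · rw [if_pos hj, h1, ← ENNReal.ofReal_mul (by positivity)]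
      apply ENNReal.ofReal_le_ofReal
      have h2 := hF.sum_interaction_le hσ hρσ (u := x j) hdj
        (v := 100 * ε * d j ^ t) (by positivity) (F.filter fun i => M i j)
        (Finset.filter_subset _ _) (fun i hi => (Finset.mem_filter.1 hi).2)
      refine h2.trans ?_
      have h3 : d j ^ t ≤ l ^ t := by
        have h4 := (le_load (t := t) hj).trans_lt hload
        rw [ENNReal.ofReal_lt_ofReal_iff (by positivity)] at h4
        have : 0 < l ^ t := by positivity
        linarith
      have h5 : d j ≤ l := (Real.rpow_le_rpow_iff hdj.le hl0.le ht0).1 h3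
      have h6 : d j ≤ l ^ (1 - t) * d j ^ t := by
        calc d j = d j ^ (1 - t) * d j ^ t := by rw [← Real.rpow_add hdj]; simp
          _ ≤ _ := by
            gcongr
      have h7 : 100 * ε * d j ^ t ≤ l ^ (1 - t) * d j ^ t := by
        gcongr
        linarith
      linarith
    · rw [if_neg hj, mul_zero, h1]
      have : (F.filter fun i => M i j) = ∅ := by
        refine Finset.filter_eq_empty_iff.2 fun i hi hij => hj ?_
        exact hij.mono (Set.inter_subset_inter_right _
          (Set.Icc_subset_Icc (hsubIcc i hi).1 (hsubIcc i hi).2))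
      simp [this]
  have hfin : ENNReal.ofReal (l / 16) ≤ ENNReal.ofReal (5 * l ^ (1 - t)) * load x d t a b := by
    calc ENNReal.ofReal (l / 16) ≤ ENNReal.ofReal (∑ i ∈ F, σ i.1) := ENNReal.ofReal_le_ofReal hsum
      _ = ∑ i ∈ F, ENNReal.ofReal (σ i.1) := ENNReal.ofReal_sum_of_nonneg fun i _ => (hσ _).le
      _ ≤ ∑ i ∈ F, ∑' j, g i j := Finset.sum_le_sum hcharge
      _ = ∑' j, ∑ i ∈ F, g i j := (Summable.tsum_finsetSum fun i _ => ENNReal.summable).symm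
      _ ≤ _ := by
          rw [load, ← ENNReal.tsum_mul_left]
          exact ENNReal.tsum_le_tsum hcost
  have hfin' := hfin.trans (mul_le_mul_right hload.le _)
  rw [← ENNReal.ofReal_mul (by positivity), ENNReal.ofReal_le_ofReal_iff (by positivity)] at hfin'
  have h8 : l ^ (1 - t) * l ^ t = l := by rw [← Real.rpow_add hl0]; simp
  nlinarith

end

/-! ### Limsup sets are not cheaply covered -/

section

variable {X : ℕ → Set ℝ} {a b : ℝ} {ι : Type*} {x d : ι → ℝ} {t : ℝ}

/-- Lower bound for the `t`-dimensional Hausdorff content of a limsup set in `[a, b]`, in the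
contrapositive: intervals of total cost less than `(b - a) ^ t / 100` do not cover it. The
uncovered point is obtained by iterating `exists_load_lt`; an interval containing it would meet
all the chosen balls, and its cost would be less than that of each of them. -/
lemma exists_mem_limsup_of_load_lt {ρ : ℕ → ℝ} (ht0 : 0 < t) (ht1 : t < 1) (hd : ∀ j, 0 < d j)
    (hρ : ∀ k, 0 < ρ k) (hρ4 : ∀ k, ρ k ^ t ≤ (4 ^ k)⁻¹)
    (hdiv : ¬ Summable fun k => (4 : ℝ) ^ k * ρ k ^ t)
    (hX : ∀ a b : ℝ, a < b → ∃ k₀, IsUbiquitous X a b k₀)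
    (hab : a < b) (hload : load x d t a b < ENNReal.ofReal ((b - a) ^ t / 100)) :
    ∃ z ∈ Set.Icc a b, (∀ N, ∃ k ≥ N, ∃ y ∈ X k, |z - y| ≤ ρ k) ∧
      ∀ j, z ∉ Metric.closedBall (x j) (d j) := by
  set P : ℝ × ℝ → Prop := fun p => p.1 < p.2 ∧
    load x d t p.1 p.2 < ENNReal.ofReal ((p.2 - p.1) ^ t / 100) with hP
  have step : ∀ (p : {p // P p}) (N : ℕ), ∃ q : {p // P p}, ∃ k ≥ N, ∃ y ∈ X k,
      q.1 = (y - ρ k, y + ρ k) ∧ p.1.1 ≤ q.1.1 ∧ q.1.2 ≤ p.1.2 := by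
    rintro ⟨⟨u, v⟩, huv, hl⟩ N
    obtain ⟨k₀, hk₀⟩ := hX u v huv
    obtain ⟨k, hk, y, hy, h1, h2, h3⟩ :=
      exists_load_lt ht0 ht1 hd hρ hρ4 hdiv hk₀ huv hl N
    refine ⟨⟨(y - ρ k, y + ρ k), ?_, ?_⟩, k, hk, y, hy, rfl, h1, h2⟩
    · have := hρ k
      change y - ρ k < y + ρ k
      linarith
    · have : y + ρ k - (y - ρ k) = 2 * ρ k := by ring
      simpa only [this] using h3
  choose next lvl hlvl ctr hctr hnext hleft hright using step
  set I : ℕ → {p // P p} := fun n => Nat.rec ⟨(a, b), hab, hload⟩ (fun n p => next p n) n with hI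
  have hI0 : (I 0).1 = (a, b) := rfl
  have hIs : ∀ n, I (n + 1) = next (I n) n := fun n => rfl
  have hanti : Antitone fun n => Set.Icc (I n).1.1 (I n).1.2 := by
    refine antitone_nat_of_succ_le fun n => ?_
    simp only [hIs]
    exact Set.Icc_subset_Icc (hleft _ _) (hright _ _)
  have hz := ciSup_mem_iInter_Icc_of_antitone_Icc hanti fun n => (I n).2.1.le
  set z := ⨆ n, (I n).1.1
  rw [Set.mem_iInter] at hz
  refine ⟨z, hz 0, fun N => ?_, fun j hj => ?_⟩
  · have h := hz (N + 1)
    rw [hIs, hnext] at h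
    refine ⟨_, hlvl (I N) N, _, hctr (I N) N, ?_⟩
    rw [abs_le]
    constructor <;> linarith [h.1, h.2]
  · have hdj := hd j
    have hbound : ∀ n : ℕ, d j ^ t ≤ (4 ^ n)⁻¹ := by
      intro n
      have h1 : ENNReal.ofReal (d j ^ t) ≤ load x d t (I (n + 1)).1.1 (I (n + 1)).1.2 :=
        le_load ⟨z, hj, hz (n + 1)⟩
      have h2 := h1.trans (I (n + 1)).2.2.le
      have h0 : 0 ≤ (I (n + 1)).1.2 - (I (n + 1)).1.1 := sub_nonneg.2 (I (n + 1)).2.1.le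
      rw [ENNReal.ofReal_le_ofReal_iff (by positivity), hIs, hnext] at h2
      set k := lvl (I n) n
      have hk : n ≤ k := hlvl (I n) n
      have h3 : ctr (I n) n + ρ k - (ctr (I n) n - ρ k) = 2 * ρ k := by ring
      simp only [h3] at h2
      have h4 : (2 : ℝ) ^ t ≤ 2 := by
        simpa using Real.rpow_le_rpow_of_exponent_le (by norm_num : (1 : ℝ) ≤ 2) ht1.le
      have h5 : (2 * ρ k) ^ t ≤ 2 * (4 ^ k)⁻¹ := by
        rw [Real.mul_rpow (by norm_num) (hρ k).le]
        have := hρ k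
        exact mul_le_mul h4 (hρ4 k) (by positivity) (by norm_num)
      have h6 : ((4 : ℝ) ^ k)⁻¹ ≤ (4 ^ n)⁻¹ := by
        gcongr
        norm_num
      have : (0 : ℝ) < (4 ^ k)⁻¹ := by positivity
      linarith
    have h4 : Filter.Tendsto (fun k : ℕ => ((4 : ℝ) ^ k)⁻¹) Filter.atTop (nhds 0) := by
      simpa [inv_pow] using tendsto_pow_atTop_nhds_zero_of_lt_one (r := (4 : ℝ)⁻¹) (by norm_num)
        (by norm_num)
    have h0 : 0 < d j ^ t := by positivity
    exact absurd (ge_of_tendsto' h4 hbound) (not_le.2 h0)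

/-- Integrating the cost of horizontal slices: boxes of half-sides `d j` with
`∑ d j ^ (t + 1)` small have a slice at some height in `[0, 1]` whose `t`-dimensional cost is
small. -/
lemma exists_slice_tsum_lt [Countable ι] (hd : ∀ j, 0 < d j) (y : ι → ℝ) {c : ENNReal}
    (hsum : ∑' j, ENNReal.ofReal (2 * d j ^ (t + 1)) < c) :
    ∃ η ∈ Set.Icc (0 : ℝ) 1,
      ∑' j : {j // η ∈ Metric.closedBall (y j) (d j)}, ENNReal.ofReal (d j ^ t) < c := by
  by_contra! hcon
  have h1 : c ≤ ∫⁻ η in Set.Icc (0 : ℝ) 1, ∑' j,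
      (Metric.closedBall (y j) (d j)).indicator (fun _ => ENNReal.ofReal (d j ^ t)) η := by
    calc c = ∫⁻ _ in Set.Icc (0 : ℝ) 1, c := by simp
      _ ≤ _ := by
        refine setLIntegral_mono' measurableSet_Icc fun η hη => (hcon η hη).trans (le_of_eq ?_)
        exact tsum_subtype {j | η ∈ Metric.closedBall (y j) (d j)}
          fun j => ENNReal.ofReal (d j ^ t)
  rw [lintegral_tsum fun j =>
    (measurable_const.indicator measurableSet_closedBall).aemeasurable] at h1
  refine absurd (h1.trans (ENNReal.tsum_le_tsum fun j => ?_)) (not_le.2 hsum)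
  have hdj := hd j
  calc _ ≤ ∫⁻ η, (Metric.closedBall (y j) (d j)).indicator (fun _ => ENNReal.ofReal (d j ^ t)) η :=
        setLIntegral_le_lintegral _ _
    _ = ENNReal.ofReal (d j ^ t) * volume (Metric.closedBall (y j) (d j)) :=
        lintegral_indicator_const measurableSet_closedBall _
    _ = ENNReal.ofReal (2 * d j ^ (t + 1)) := by
        rw [Real.volume_closedBall, ← ENNReal.ofReal_mul (by positivity),
          Real.rpow_add_one hdj.ne']
        congr 1; ring

end

/-! ### Hausdorff measure of products with an interval -/

section

variable {t : ℝ}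

lemma abs_sub_le_ediam {T : Set (EuclideanSpace ℝ (Fin 2))} (hT : Metric.ediam T ≠ ⊤)
    {u v : EuclideanSpace ℝ (Fin 2)} (hu : u ∈ T) (hv : v ∈ T) (i : Fin 2) :
    |u i - v i| ≤ (Metric.ediam T).toReal := by
  calc |u i - v i| = ‖(u - v) i‖ := by simp
    _ ≤ ‖u - v‖ := PiLp.norm_apply_le _ _
    _ = dist u v := (dist_eq_norm _ _).symm
    _ ≤ _ := Metric.dist_le_diam_of_mem' hT hu hv

/-- If `W ∩ [a, b]` cannot be covered by intervals of small `t`-dimensional cost, then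
`(W ∩ [a, b]) × [0, 1]` has `(t + 1)`-dimensional Hausdorff measure bounded below. -/
lemma le_hausdorffMeasure_of_not_covered (ht0 : 0 < t) {W : Set ℝ} {a b : ℝ} (hab : a < b)
    (hW : ∀ (ι : Type) (x d : ι → ℝ), (∀ j, 0 < d j) →
      ∑' j, ENNReal.ofReal (d j ^ t) < ENNReal.ofReal ((b - a) ^ t / 100) →
        ∃ z ∈ Set.Icc a b, z ∈ W ∧ ∀ j, z ∉ Metric.closedBall (x j) (d j)) :
    ENNReal.ofReal ((b - a) ^ t / 400) ≤ Measure.hausdorffMeasure (t + 1)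
      {v : EuclideanSpace ℝ (Fin 2) | v 0 ∈ W ∧ v 0 ∈ Set.Icc a b ∧ v 1 ∈ Set.Icc (0 : ℝ) 1} := by
  have hba : 0 < b - a := by linarith
  have hs : 0 < t + 1 := by linarith
  rw [Measure.hausdorffMeasure_apply]
  refine le_trans ?_ (le_iSup₂_of_le 1 zero_lt_one le_rfl)
  refine le_iInf fun T => le_iInf fun hT => le_iInf fun hdiam => ?_
  by_contra! hlt
  have hne : ENNReal.ofReal ((b - a) ^ t / 400) ≠ 0 := by
    rw [ENNReal.ofReal_ne_zero_iff]; positivity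
  have hfin : ∀ n, Metric.ediam (T n) ≠ ⊤ := fun n =>
    ne_top_of_le_ne_top ENNReal.one_ne_top (hdiam n)
  set ι := {n // (T n).Nonempty}
  -- the radii are enlarged a little to make them positive
  obtain ⟨e, he0, he⟩ := ENNReal.exists_pos_sum_of_countable hne ι
  choose p hp using fun n : ι => n.2
  set D : ι → ℝ := fun n => (Metric.ediam (T n)).toReal with hD
  have hD0 : ∀ n, 0 ≤ D n := fun n => ENNReal.toReal_nonneg
  set d : ι → ℝ := fun n => (D n ^ (t + 1) + e n) ^ (t + 1)⁻¹ with hddef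
  have hpos : ∀ n, 0 < D n ^ (t + 1) + e n := fun n => by
    have h1 : (0 : ℝ) < e n := he0 n
    have h2 := hD0 n
    positivity
  have hd : ∀ n, 0 < d n := fun n => Real.rpow_pos_of_pos (hpos n) _
  have hds : ∀ n, d n ^ (t + 1) = D n ^ (t + 1) + e n := fun n =>
    Real.rpow_inv_rpow (hpos n).le hs.ne'
  have hDd : ∀ n, D n ≤ d n := fun n => by
    rw [← Real.rpow_le_rpow_iff (hD0 n) (hd n).le hs, hds]
    exact le_add_of_nonneg_right (e n).2
  have hsumD : ∑' n, ENNReal.ofReal (D n ^ (t + 1)) < ENNReal.ofReal ((b - a) ^ t / 400) := by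
    refine lt_of_le_of_lt ?_ hlt
    refine (le_of_eq (tsum_subtype {n | (T n).Nonempty}
      fun n => ENNReal.ofReal ((Metric.ediam (T n)).toReal ^ (t + 1)))).trans ?_
    refine ENNReal.tsum_le_tsum fun n => ?_
    by_cases hn : (T n).Nonempty
    · rw [Set.indicator_of_mem (show n ∈ {n | (T n).Nonempty} from hn), iSup_pos hn,
        ← ENNReal.ofReal_rpow_of_nonneg ENNReal.toReal_nonneg hs.le,
        ENNReal.ofReal_toReal (hfin n)]
    · rw [Set.indicator_of_notMem (show n ∉ {n | (T n).Nonempty} from hn)]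
      exact bot_le
  have hsum : ∑' n, ENNReal.ofReal (2 * d n ^ (t + 1)) < ENNReal.ofReal ((b - a) ^ t / 100) := by
    have h1 : ∀ n, ENNReal.ofReal (2 * d n ^ (t + 1)) =
        2 * (ENNReal.ofReal (D n ^ (t + 1)) + e n) := by
      intro n
      rw [hds, ENNReal.ofReal_mul (by norm_num),
        ENNReal.ofReal_add (by have := hD0 n; positivity) (NNReal.coe_nonneg _),
        ENNReal.ofReal_coe_nnreal]
      simp
    simp only [h1]
    rw [ENNReal.tsum_mul_left, ENNReal.tsum_add]
    have h2 : ENNReal.ofReal ((b - a) ^ t / 100) =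
        2 * (ENNReal.ofReal ((b - a) ^ t / 400) + ENNReal.ofReal ((b - a) ^ t / 400)) := by
      rw [← ENNReal.ofReal_add (by positivity) (by positivity), ← ENNReal.ofReal_ofNat,
        ← ENNReal.ofReal_mul (by norm_num)]
      congr 1; ring
    rw [h2]
    exact ENNReal.mul_lt_mul_right (by norm_num) (by norm_num) (ENNReal.add_lt_add hsumD he)
  obtain ⟨η, hη, hslice⟩ := exists_slice_tsum_lt hd (fun n => p n 1) hsum
  obtain ⟨z, hz, hzW, hzn⟩ := hW {n // η ∈ Metric.closedBall (p n 1) (d n)}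
    (fun n => p n.1 0) (fun n => d n.1) (fun n => hd _) hslice
  obtain ⟨n, hn⟩ := Set.mem_iUnion.1 (hT (show !₂[z, η] ∈ _ from ⟨hzW, hz, hη⟩))
  have hmem := fun i => (abs_sub_le_ediam (hfin n) hn (hp ⟨n, _, hn⟩) i).trans (hDd ⟨n, _, hn⟩)
  refine hzn ⟨⟨n, _, hn⟩, ?_⟩ ?_
  · exact hmem 1
  · exact hmem 0

/-- A lower bound of order `(b - a) ^ t` with `t < 1` for the measure of every vertical strip of
`A` makes the measure of `A` infinite: cut into `M` strips and let `M` tend to infinity. -/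
lemma hausdorffMeasure_eq_top_of_strips (ht1 : t < 1) {s : ℝ} {c : ℝ} (hc : 0 < c)
    {A : Set (EuclideanSpace ℝ (Fin 2))}
    (hA : ∀ a b : ℝ, a < b → 0 ≤ a → b ≤ 1 → ENNReal.ofReal ((b - a) ^ t * c) ≤
      Measure.hausdorffMeasure s ({v | v 0 ∈ Set.Icc a b} ∩ A)) :
    Measure.hausdorffMeasure s A = ⊤ := by
  set μ := (Measure.hausdorffMeasure s : Measure (EuclideanSpace ℝ (Fin 2))) with hμ
  have key : ∀ n : ℕ, ENNReal.ofReal (((n : ℝ) + 1) ^ (1 - t) * ((1 / 2) ^ t * c)) ≤ μ A := by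
    intro n
    have hM : (0 : ℝ) < n + 1 := by positivity
    set L : ℕ → Set (EuclideanSpace ℝ (Fin 2)) := fun i =>
      {v | v 0 ∈ Set.Icc ((i : ℝ) / (n + 1)) ((i + 1 / 2 : ℝ) / (n + 1))} with hL
    have hmeas : ∀ i, MeasurableSet (L i) := fun i =>
      (IsClosed.preimage (by fun_prop) isClosed_Icc).measurableSet
    have hdisj : Pairwise (Function.onFun Disjoint L) := by
      have : ∀ i j, i < j → Disjoint (L i) (L j) := by
        intro i j hij
        rw [Set.disjoint_left]
        rintro v ⟨-, hv⟩ ⟨hv', -⟩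
        have h1 := hv'.trans hv
        rw [div_le_div_iff_of_pos_right hM] at h1
        have : (i : ℝ) + 1 ≤ j := by exact_mod_cast hij
        linarith
      intro i j hij
      rcases lt_or_gt_of_ne hij with h | h
      exacts [this i j h, (this j i h).symm]
    have hone : ∀ i ∈ Finset.range (n + 1),
        ENNReal.ofReal ((1 / 2 / ((n : ℝ) + 1)) ^ t * c) ≤ μ.restrict A (L i) := by
      intro i hi
      rw [Measure.restrict_apply (hmeas i)]
      have hi' : (i : ℝ) + 1 ≤ n + 1 := by exact_mod_cast Finset.mem_range.1 hi
      refine le_trans (le_of_eq ?_) (hA _ _ ?_ (by positivity) ?_)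
      · congr 3; ring
      · gcongr; linarith
      · rw [div_le_one hM]; linarith
    calc ENNReal.ofReal (((n : ℝ) + 1) ^ (1 - t) * ((1 / 2) ^ t * c))
        = ∑ i ∈ Finset.range (n + 1), ENNReal.ofReal ((1 / 2 / ((n : ℝ) + 1)) ^ t * c) := by
          rw [Finset.sum_const, Finset.card_range, nsmul_eq_mul, ← ENNReal.ofReal_natCast,
            ← ENNReal.ofReal_mul (by positivity)]
          congr 1
          rw [Real.div_rpow (by norm_num) hM.le, Real.rpow_sub hM, Real.rpow_one]
          push_cast
          ring
      _ ≤ ∑ i ∈ Finset.range (n + 1), μ.restrict A (L i) := Finset.sum_le_sum hone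
      _ = μ.restrict A (⋃ i ∈ Finset.range (n + 1), L i) :=
          (measure_biUnion_finset (hdisj.set_pairwise _) fun i _ => hmeas i).symm
      _ ≤ μ A := (measure_mono (Set.subset_univ _)).trans (by simp)
  have htend : Filter.Tendsto (fun n : ℕ => ((n : ℝ) + 1) ^ (1 - t) * ((1 / 2) ^ t * c))
      Filter.atTop Filter.atTop := by
    refine Filter.Tendsto.atTop_mul_const (by positivity) ?_
    exact (tendsto_rpow_atTop (by linarith)).comp
      (Filter.tendsto_atTop_add_const_right _ _ tendsto_natCast_atTop_atTop)
  exact top_le_iff.1 (le_of_tendsto' (ENNReal.tendsto_ofReal_atTop.comp htend) key)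

end

/-! ### Divergence -/

section

variable {t : ℝ}

/-- Cauchy condensation for the series `∑ q * g q` with `g` decreasing, in the direction needed
for divergence. -/
lemma summable_mul_of_condensed {g : ℕ → ℝ} (hg0 : ∀ q, 1 ≤ q → 0 ≤ g q)
    (hg : ∀ q r, 1 ≤ q → q ≤ r → g r ≤ g q)
    (h : Summable fun k : ℕ => (4 : ℝ) ^ k * g (2 ^ (k + 1))) :
    Summable fun q : ℕ => ((q + 1 : ℕ) : ℝ) * g (q + 1) := by
  have h4 : Summable fun k : ℕ => (4 : ℝ) ^ k * g (2 ^ k) := by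
    rw [← summable_nat_add_iff 1]
    refine (h.mul_left 4).congr fun k => ?_
    rw [pow_succ (4 : ℝ)]; ring
  have hterm : ∀ q : ℕ, 0 ≤ (q : ℝ) * g q := by
    intro q
    rcases Nat.eq_zero_or_pos q with rfl | hq
    · simp
    · exact mul_nonneg (Nat.cast_nonneg _) (hg0 q hq)
  have hblock : ∀ n : ℕ, ∑ q ∈ Finset.range (2 ^ n), (q : ℝ) * g q ≤
      2 * ∑ k ∈ Finset.range n, (4 : ℝ) ^ k * g (2 ^ k) := by
    intro n
    induction n with
    | zero => simp
    | succ n ih =>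
      have hle : 2 ^ n ≤ 2 ^ (n + 1) := Nat.pow_le_pow_right (by norm_num) (by omega)
      rw [← Finset.sum_range_add_sum_Ico _ hle, Finset.sum_range_succ, mul_add]
      refine add_le_add ih ?_
      calc ∑ q ∈ Finset.Ico (2 ^ n) (2 ^ (n + 1) : ℕ), (q : ℝ) * g q
          ≤ ∑ q ∈ Finset.Ico (2 ^ n) (2 ^ (n + 1) : ℕ), (2 : ℝ) ^ (n + 1) * g (2 ^ n) := by
            refine Finset.sum_le_sum fun q hq => ?_
            rw [Finset.mem_Ico] at hq
            have h1 : 1 ≤ q := Nat.one_le_two_pow.trans hq.1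
            exact mul_le_mul (by exact_mod_cast hq.2.le) (hg _ _ Nat.one_le_two_pow hq.1)
              (hg0 q h1) (by positivity)
        _ = 2 * (4 ^ n * g (2 ^ n)) := by
            have h5 : 2 ^ (n + 1) - 2 ^ n = 2 ^ n := by rw [pow_succ]; omega
            rw [Finset.sum_const, Nat.card_Ico, h5, nsmul_eq_mul]
            push_cast
            rw [show (4 : ℝ) = 2 * 2 by norm_num, mul_pow, pow_succ]
            ring
  have hmain : Summable fun q : ℕ => (q : ℝ) * g q := by
    refine summable_of_sum_range_le hterm (c := 2 * ∑' k, (4 : ℝ) ^ k * g (2 ^ k)) fun n => ?_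
    calc ∑ q ∈ Finset.range n, (q : ℝ) * g q
        ≤ ∑ q ∈ Finset.range (2 ^ n), (q : ℝ) * g q :=
          Finset.sum_le_sum_of_subset_of_nonneg
            (Finset.range_mono Nat.lt_two_pow_self.le) fun q _ _ => hterm q
      _ ≤ _ := hblock n
      _ ≤ _ := by
          gcongr
          exact h4.sum_le_tsum _ fun k _ => mul_nonneg (by positivity) (hg0 _ Nat.one_le_two_pow)
  exact (summable_nat_add_iff 1).2 hmain

/-- Capping the terms of a divergent series keeps it divergent. -/
lemma not_summable_mul_min {u : ℕ → ℝ}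
    (h : ¬ Summable fun k : ℕ => (4 : ℝ) ^ k * u k) :
    ¬ Summable fun k : ℕ => (4 : ℝ) ^ k * min (u k) (4 ^ k)⁻¹ := by
  intro hs
  refine h (hs.congr_atTop ?_)
  filter_upwards [hs.tendsto_atTop_zero.eventually_lt_const one_pos] with k hk
  have h4 : (0 : ℝ) < 4 ^ k := by positivity
  rcases le_total (u k) (4 ^ k)⁻¹ with hle | hle
  · rw [min_eq_left hle]
  · rw [min_eq_right hle, mul_inv_cancel₀ h4.ne'] at hk
    exact absurd hk (lt_irrefl _)

lemma distInt_nonneg (x : ℝ) : 0 ≤ distInt x := abs_nonneg _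

/-- A point whose first coordinate is close to infinitely many shifted fractions is
multiplicatively approximable, the second factor being trivially at most `1 / 2`. -/
lemma mem_multApprox_of_forall_exists {ψ : ℕ → ℝ} (hψ : IsApproximatingFunction ψ)
    (θ v : EuclideanSpace ℝ (Fin 2))
    (h : ∀ N, ∃ k ≥ N, ∃ y ∈ shiftedFractions (θ 0) k,
      |v 0 - y| < ψ (2 ^ (k + 1)) / 2 ^ (k + 1)) : v ∈ multApprox 2 ψ θ := by
  refine Set.infinite_of_forall_exists_gt fun N => ?_
  obtain ⟨k, hk, y, ⟨q, hq1, hq2, p, rfl⟩, hy⟩ := h N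
  have hNq : N < q := (hk.trans Nat.lt_two_pow_self.le).trans_lt hq1
  have hq : 1 ≤ q := by omega
  have hqR : (0 : ℝ) < q := by exact_mod_cast hq
  refine ⟨q, ⟨hq, ?_⟩, hNq⟩
  have hψq := hψ.antitone q _ hq hq2
  have h0 := hψ.pos (2 ^ (k + 1)) Nat.one_le_two_pow
  have h1 : |v 0 - (p + θ 0) / q| < ψ q / q := by
    refine hy.trans_le (div_le_div₀ (hψ.pos q hq).le hψq hqR ?_)
    simpa using (Nat.cast_le (α := ℝ)).2 hq2
  have h2 : distInt (q * v 0 - θ 0) < ψ q := by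
    refine (round_le _ p).trans_lt ?_
    have h3 : (q : ℝ) * v 0 - θ 0 - p = q * (v 0 - (p + θ 0) / q) := by field_simp; ring
    rw [h3, abs_mul, abs_of_pos hqR]
    rwa [lt_div_iff₀' hqR] at h1
  rw [Fin.prod_univ_two]
  have h4 : distInt (q * v 1 - θ 1) ≤ 1 / 2 := abs_sub_round _
  have h5 := distInt_nonneg (q * v 0 - θ 0)
  have h6 := distInt_nonneg (q * v 1 - θ 1)
  nlinarith

theorem hausdorffMeasure_multApprox_eq_top {ψ : ℕ → ℝ} (hψ : IsApproximatingFunction ψ)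
    (θ : EuclideanSpace ℝ (Fin 2)) (ht0 : 0 < t) (ht1 : t < 1)
    (hdiv : ¬ Summable fun q : ℕ => ((q + 1 : ℕ) : ℝ) ^ (1 - t) * ψ (q + 1) ^ t) :
    Measure.hausdorffMeasure (t + 1) (multApprox 2 ψ θ ∩ unitCube 2) = ⊤ := by
  set R : ℕ → ℝ := fun q => ψ q / q with hR
  have hR0 : ∀ q, 1 ≤ q → 0 < R q := fun q hq =>
    div_pos (hψ.pos q hq) (by exact_mod_cast hq)
  have hRanti : ∀ q r, 1 ≤ q → q ≤ r → R r ≤ R q := fun q r hq hqr =>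
    div_le_div₀ (hψ.pos q hq).le (hψ.antitone q r hq hqr) (by exact_mod_cast hq)
      (by exact_mod_cast hqr)
  have hRk : ∀ k : ℕ, 0 < R (2 ^ (k + 1)) := fun k => hR0 _ Nat.one_le_two_pow
  have hdiv1 : ¬ Summable fun k : ℕ => (4 : ℝ) ^ k * R (2 ^ (k + 1)) ^ t := by
    intro h
    refine hdiv ((summable_mul_of_condensed (g := fun q => R q ^ t)
      (fun q hq => Real.rpow_nonneg (hR0 q hq).le _)
      (fun q r hq hqr => Real.rpow_le_rpow (hR0 r (hq.trans hqr)).le (hRanti q r hq hqr) ht0.le)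
      h).congr fun q => ?_)
    have hq : (0 : ℝ) < ((q + 1 : ℕ) : ℝ) := by positivity
    simp only [hR]
    rw [Real.div_rpow (hψ.pos (q + 1) (by omega)).le hq.le, Real.rpow_sub hq, Real.rpow_one]
    ring
  -- The cap makes `ρ k ^ t ≤ 4 ^ (-k)`, the scale of ubiquity, and the factor `1 / 2` turns weak
  -- inequalities into strict ones.
  set ρ : ℕ → ℝ := fun k => min (R (2 ^ (k + 1)) / 2) (((4 : ℝ) ^ k)⁻¹ ^ t⁻¹) with hρdef
  have hρ : ∀ k, 0 < ρ k := fun k => lt_min (half_pos (hRk k)) (by positivity)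
  have hρt : ∀ k, ρ k ^ t = min ((R (2 ^ (k + 1)) / 2) ^ t) (4 ^ k)⁻¹ := by
    intro k
    have hmono : MonotoneOn (fun r : ℝ => r ^ t) (Set.Ici 0) := fun u hu v _ huv =>
      Real.rpow_le_rpow hu huv ht0.le
    refine (hmono.map_min (a := R (2 ^ (k + 1)) / 2) (b := ((4 : ℝ) ^ k)⁻¹ ^ t⁻¹)
      (half_pos (hRk k)).le (Set.mem_Ici.2 (by positivity))).trans ?_
    simp only [Real.rpow_inv_rpow (show (0 : ℝ) ≤ (4 ^ k)⁻¹ by positivity) ht0.ne']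
  have hρ4 : ∀ k, ρ k ^ t ≤ (4 ^ k)⁻¹ := fun k => (hρt k).trans_le (min_le_right _ _)
  have hdivρ : ¬ Summable fun k : ℕ => (4 : ℝ) ^ k * ρ k ^ t := by
    simp only [hρt]
    refine not_summable_mul_min fun h => hdiv1 ((h.mul_left (2 ^ t)).congr fun k => ?_)
    rw [Real.div_rpow (hRk k).le (by norm_num)]
    have : (0 : ℝ) < 2 ^ t := by positivity
    field_simp
  refine hausdorffMeasure_eq_top_of_strips ht1 (c := 1 / 400) (by norm_num)
    fun a b hab ha hb => ?_
  set W : Set ℝ := {z | ∀ N, ∃ k ≥ N, ∃ y ∈ shiftedFractions (θ 0) k, |z - y| ≤ ρ k} with hW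
  rw [mul_one_div]
  refine (le_hausdorffMeasure_of_not_covered ht0 (W := W) hab fun ι x d hd hsum => ?_).trans
    (measure_mono ?_)
  · classical
    have hload : load x d t a b < ENNReal.ofReal ((b - a) ^ t / 100) := by
      refine lt_of_le_of_lt (ENNReal.tsum_le_tsum fun j => ?_) hsum
      split_ifs
      exacts [le_rfl, zero_le]
    exact exists_mem_limsup_of_load_lt ht0 ht1 hd hρ hρ4 hdivρ
      (fun a b hab => exists_isUbiquitous_shiftedFractions (θ 0) a b hab) hab hload
  · rintro v ⟨hvW, hv0, hv1⟩
    refine ⟨hv0, mem_multApprox_of_forall_exists hψ θ v fun N => ?_, ?_⟩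
    · obtain ⟨k, hk, y, hy, hvy⟩ := hvW N
      refine ⟨k, hk, y, hy, hvy.trans_lt ?_⟩
      have h1 := min_le_left (R (2 ^ (k + 1)) / 2) (((4 : ℝ) ^ k)⁻¹ ^ t⁻¹)
      have h2 := hRk k
      have h3 : R (2 ^ (k + 1)) = ψ (2 ^ (k + 1)) / 2 ^ (k + 1) := by simp [hR]
      rw [← h3]
      simp only [hρdef]
      linarith
    · intro i
      fin_cases i
      exacts [⟨ha.trans hv0.1, hv0.2.trans hb⟩, hv1]

end

/-! ### Convergence -/

section

variable {t : ℝ}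

/-- The size-`r` approximation to `s`-dimensional Hausdorff measure on the plane: the infimum of
`∑ diam ^ s` over countable covers by sets of diameter at most `r`. -/
def hausdorffPre (s : ℝ) (r : ENNReal) : OuterMeasure (EuclideanSpace ℝ (Fin 2)) :=
  OuterMeasure.mkMetric'.pre (fun A => Metric.ediam A ^ s) r

lemma hausdorffMeasure_eq_zero_of_pre {s : ℝ} {A : Set (EuclideanSpace ℝ (Fin 2))}
    (h : ∀ r > 0, hausdorffPre s r A = 0) : Measure.hausdorffMeasure s A = 0 := by
  rw [Measure.hausdorffMeasure, ← OuterMeasure.coe_mkMetric]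
  have : OuterMeasure.mkMetric (X := EuclideanSpace ℝ (Fin 2)) (fun r => r ^ s) A =
      ⨆ (r : ENNReal) (_ : 0 < r), hausdorffPre s r A := by
    simp [OuterMeasure.mkMetric, OuterMeasure.mkMetric', hausdorffPre, OuterMeasure.iSup_apply]
  rw [this]
  simpa using h

/-- The rectangle with centre `c`, of half-side `H` in direction `i` and `h` in the other. -/
def rectangle (c : Fin 2 → ℝ) (i : Fin 2) (H h : ℝ) : Set (EuclideanSpace ℝ (Fin 2)) :=
  {v | ∀ j, |v j - c j| ≤ if j = i then H else h}

lemma ediam_rectangle_self_le (c : Fin 2 → ℝ) (i : Fin 2) {h : ℝ} (hh : 0 ≤ h) :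
    Metric.ediam (rectangle c i h h) ≤ ENNReal.ofReal (4 * h) := by
  refine Metric.ediam_le_of_forall_dist_le fun u hu v hv => ?_
  simp only [rectangle, ite_self, Set.mem_ofPred_eq] at hu hv
  have hc : ∀ j, (u j - v j) ^ 2 ≤ (2 * h) ^ 2 := by
    intro j
    rw [sq_le_sq, abs_of_nonneg (by positivity : 0 ≤ 2 * h)]
    have h1 := abs_sub_le (u j) (c j) (v j)
    rw [abs_sub_comm (c j)] at h1
    linarith [hu j, hv j]
  rw [EuclideanSpace.dist_eq, Real.sqrt_le_iff]
  refine ⟨by positivity, ?_⟩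
  simp only [Fin.sum_univ_two, Real.dist_eq, sq_abs]
  nlinarith [hc 0, hc 1]

/-- A rectangle is cut into squares of the length of its shorter side. -/
lemma hausdorffPre_rectangle_le (ht0 : 0 < t) (ht1 : t < 1) {r : ENNReal} (c : Fin 2 → ℝ)
    (i : Fin 2) {H h : ℝ} (hh : 0 < h) (hH : h ≤ H) (hr : ENNReal.ofReal (4 * h) ≤ r) :
    hausdorffPre (t + 1) r (rectangle c i H h) ≤ ENNReal.ofReal (32 * (H * h ^ t)) := by
  set n := ⌈H / h⌉₊ with hn
  have hn1 : H / h ≤ n := Nat.le_ceil _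
  have h1 : 1 ≤ H / h := (one_le_div hh).2 hH
  have hn2 : (n : ℝ) < H / h + 1 := Nat.ceil_lt_add_one (by positivity)
  rw [div_le_iff₀ hh] at hn1
  have hcover : rectangle c i H h ⊆ ⋃ m ∈ Finset.range n,
      rectangle (Function.update c i (c i - H + (2 * m + 1) * h)) i h h := by
    intro v hv
    have hvi := hv i
    rw [if_pos rfl, abs_le] at hvi
    -- the index is capped at `n - 1` for the right end of the rectangle
    set y := v i - c i + H with hy
    have hy0 : 0 ≤ y := by linarith
    have hfl : (⌊y / (2 * h)⌋₊ : ℝ) ≤ y / (2 * h) := Nat.floor_le (by positivity)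
    have hfl2 : y / (2 * h) < ⌊y / (2 * h)⌋₊ + 1 := Nat.lt_floor_add_one _
    rw [le_div_iff₀ (by positivity)] at hfl
    rw [div_lt_iff₀ (by positivity)] at hfl2
    have hnpos : 0 < n := Nat.ceil_pos.2 (by positivity)
    obtain ⟨m, hm, hm1, hm2⟩ : ∃ m, m < n ∧ 2 * m * h ≤ y ∧ y ≤ 2 * (m + 1) * h := by
      by_cases hcase : ⌊y / (2 * h)⌋₊ < n
      · exact ⟨_, hcase, by linarith, by linarith⟩
      · have h3 : (n : ℝ) ≤ ⌊y / (2 * h)⌋₊ := by exact_mod_cast not_lt.1 hcase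
        have h4 : ((n - 1 : ℕ) : ℝ) = n - 1 := by rw [Nat.cast_sub hnpos, Nat.cast_one]
        refine ⟨n - 1, by omega, ?_, ?_⟩
        · rw [h4]; nlinarith
        · rw [h4]; nlinarith
    simp only [Set.mem_iUnion, Finset.mem_range, exists_prop]
    refine ⟨m, hm, fun j => ?_⟩
    by_cases hj : j = i
    · subst hj
      rw [Function.update_self, if_pos rfl, abs_le]
      constructor <;> linarith
    · rw [Function.update_of_ne hj, if_neg hj]
      simpa [if_neg hj] using hv j
  have hone : ∀ c', hausdorffPre (t + 1) r (rectangle c' i h h) ≤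
      ENNReal.ofReal (16 * (h * h ^ t)) := by
    intro c'
    have hdiam := ediam_rectangle_self_le c' i hh.le
    refine (OuterMeasure.mkMetric'.pre_le (hdiam.trans hr)).trans ?_
    refine (ENNReal.rpow_le_rpow hdiam (by linarith)).trans ?_
    rw [ENNReal.ofReal_rpow_of_nonneg (by positivity) (by linarith)]
    apply ENNReal.ofReal_le_ofReal
    rw [Real.mul_rpow (by norm_num) hh.le, Real.rpow_add_one hh.ne', mul_comm h]
    gcongr
    calc (4 : ℝ) ^ (t + 1) ≤ 4 ^ (2 : ℝ) :=
          Real.rpow_le_rpow_of_exponent_le (by norm_num) (by linarith)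
      _ = 16 := by norm_num
  calc hausdorffPre (t + 1) r (rectangle c i H h)
      ≤ ∑ m ∈ Finset.range n, ENNReal.ofReal (16 * (h * h ^ t)) := by
        refine (measure_mono hcover).trans ((measure_biUnion_finset_le _ _).trans ?_)
        exact Finset.sum_le_sum fun m _ => hone _
    _ = ENNReal.ofReal (n * (16 * (h * h ^ t))) := by
        rw [Finset.sum_const, Finset.card_range, nsmul_eq_mul,
          ENNReal.ofReal_mul (Nat.cast_nonneg _), ENNReal.ofReal_natCast]
    _ ≤ _ := by
        apply ENNReal.ofReal_le_ofReal
        have h2 : n * h ≤ 2 * H := by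
          have : (n : ℝ) ≤ 2 * (H / h) := by linarith
          calc n * h ≤ 2 * (H / h) * h := by gcongr
            _ = 2 * H := by field_simp
        have h3 : 0 < h ^ t := by positivity
        nlinarith

/-- The points of the unit square satisfying the approximation condition for a single `q`. -/
def approxAt (ψ : ℕ → ℝ) (θ : EuclideanSpace ℝ (Fin 2)) (q : ℕ) :
    Set (EuclideanSpace ℝ (Fin 2)) :=
  {v | v ∈ unitCube 2 ∧ ∏ i, distInt ((q : ℝ) * v i - θ i) < ψ q}

/-- Numerators `p` for which the shifted fraction `(p + θ i) / q` can matter for `[0, 1]`. -/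
def numerators (θ : EuclideanSpace ℝ (Fin 2)) (q : ℕ) : Finset (Fin 2 → ℤ) :=
  Fintype.piFinset fun j => Finset.Icc ⌈-θ j - 1⌉ ⌊(q : ℝ) - θ j + 1⌋

lemma card_numerators_le (θ : EuclideanSpace ℝ (Fin 2)) {q : ℕ} (hq : 1 ≤ q) :
    ((numerators θ q).card : ℝ) ≤ 16 * (q : ℝ) ^ 2 := by
  have hqR : (1 : ℝ) ≤ q := by exact_mod_cast hq
  have h1 : ∀ j, ((Finset.Icc ⌈-θ j - 1⌉ ⌊(q : ℝ) - θ j + 1⌋).card : ℝ) ≤ 4 * q := by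
    intro j
    have h2 := Int.floor_le ((q : ℝ) - θ j + 1)
    have h3 := Int.le_ceil (-θ j - 1)
    rw [Int.card_Icc]
    rw [← Int.cast_natCast, Int.toNat_eq_max]
    push_cast
    exact max_le (by linarith) (by linarith)
  rw [numerators, Fintype.card_piFinset, Fin.prod_univ_two]
  push_cast
  calc _ ≤ (4 * q : ℝ) * (4 * q) := mul_le_mul (h1 0) (h1 1) (by positivity) (by positivity)
    _ = _ := by ring

/-- The set for a single `q` is covered by rectangles around the shifted rational points. With `u`
the vector of distances to the nearest integers, `i` the direction of the larger entry and
`2 ^ (-k)` its dyadic size, the other entry is at most `min (2 ^ (k + 1) * ψ q) (2 ^ (-k))`. -/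
lemma approxAt_subset (ψ : ℕ → ℝ) (θ : EuclideanSpace ℝ (Fin 2)) {q : ℕ} (hq : 1 ≤ q)
    (hψ : 0 < ψ q) : approxAt ψ θ q ⊆ ⋃ i : Fin 2, ⋃ p ∈ numerators θ q, ⋃ k : ℕ,
      rectangle (fun j => ((p j : ℝ) + θ j) / q) i ((1 / 2) ^ k / q)
        (min (2 ^ (k + 1) * ψ q) ((1 / 2) ^ k) / q) := by
  rintro v ⟨hv, hprod⟩
  have hqR : (0 : ℝ) < q := by exact_mod_cast hq
  set p : Fin 2 → ℤ := fun j => round ((q : ℝ) * v j - θ j) with hp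
  set u : Fin 2 → ℝ := fun j => distInt ((q : ℝ) * v j - θ j) with hu
  have hu0 : ∀ j, 0 ≤ u j := fun j => distInt_nonneg _
  have huhalf : ∀ j, u j ≤ 1 / 2 := fun j => abs_sub_round _
  have hup : ∀ j, |(q : ℝ) * v j - θ j - p j| = u j := fun j => rfl
  have hvu : ∀ j, |v j - ((p j : ℝ) + θ j) / q| = u j / q := by
    intro j
    have : v j - ((p j : ℝ) + θ j) / q = ((q : ℝ) * v j - θ j - p j) / q := by field_simp; ring
    rw [this, abs_div, hup, abs_of_pos hqR]
  have hmem : p ∈ numerators θ q := by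
    refine Fintype.mem_piFinset.2 fun j => Finset.mem_Icc.2 ⟨Int.ceil_le.2 ?_, Int.le_floor.2 ?_⟩
    all_goals
      have h1 := huhalf j
      rw [← hup, abs_le] at h1
      have h2 : 0 ≤ (q : ℝ) * v j := mul_nonneg hqR.le (hv j).1
      have h3 : (q : ℝ) * v j ≤ q := mul_le_of_le_one_right hqR.le (hv j).2
      linarith [h1.1, h1.2]
  obtain ⟨i, hi⟩ := Finite.exists_max u
  have hprod' : ∀ j, j ≠ i → u j * u i < ψ q := by
    rw [Fin.prod_univ_two] at hprod
    intro j hj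
    fin_cases i <;> fin_cases j
    · exact absurd rfl hj
    · rw [mul_comm]; exact hprod
    · exact hprod
    · exact absurd rfl hj
  obtain ⟨k, hk1, hk2⟩ : ∃ k : ℕ, u i ≤ (1 / 2) ^ k ∧ ∀ j, j ≠ i → u j ≤ 2 ^ (k + 1) * ψ q := by
    rcases (hu0 i).eq_or_lt with h0 | h0
    · exact ⟨0, by rw [← h0]; norm_num, fun j _ => (hi j).trans (by rw [← h0]; positivity)⟩
    · obtain ⟨k, hk1, hk2⟩ := exists_nat_pow_near_of_lt_one h0
        ((huhalf i).trans (by norm_num)) (by norm_num : (0 : ℝ) < 1 / 2) (by norm_num)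
      refine ⟨k, hk2, fun j hj => ?_⟩
      have h1 := hprod' j hj
      have h2 : u j * (1 / 2) ^ (k + 1) ≤ ψ q :=
        (mul_le_mul_of_nonneg_left hk1.le (hu0 j)).trans h1.le
      rw [one_div, inv_pow, ← div_eq_mul_inv, div_le_iff₀ (by positivity)] at h2
      linarith
  simp only [Set.mem_iUnion]
  refine ⟨i, p, hmem, k, fun j => ?_⟩
  rw [hvu]
  split_ifs with hj
  · rw [hj]; gcongr
  · gcongr
    exact le_min (hk2 j hj) ((hi j).trans hk1)

lemma hausdorffPre_approxAt_le (ht0 : 0 < t) (ht1 : t < 1) (ψ : ℕ → ℝ)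
    (θ : EuclideanSpace ℝ (Fin 2)) {q : ℕ} (hq : 1 ≤ q) (hψ : 0 < ψ q) {r : ENNReal}
    (hr : ENNReal.ofReal (4 / q) ≤ r) :
    hausdorffPre (t + 1) r (approxAt ψ θ q) ≤
      ENNReal.ofReal (2048 * (1 - 2 ^ (t - 1))⁻¹ * ((q : ℝ) ^ (1 - t) * ψ q ^ t)) := by
  have hqR : (0 : ℝ) < q := by exact_mod_cast hq
  set β : ℝ := 2 ^ (t - 1) with hβ
  have hβ0 : 0 < β := by positivity
  have hβ1 : β < 1 := Real.rpow_lt_one_of_one_lt_of_neg (by norm_num) (by linarith)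
  set A : ℝ := 64 * ((q : ℝ)⁻¹ * (ψ q / q) ^ t) with hA
  have hA0 : 0 ≤ A := by positivity
  have hrect : ∀ (c : Fin 2 → ℝ) (i : Fin 2) (k : ℕ),
      hausdorffPre (t + 1) r (rectangle c i ((1 / 2) ^ k / q)
        (min (2 ^ (k + 1) * ψ q) ((1 / 2) ^ k) / q)) ≤ ENNReal.ofReal (A * β ^ k) := by
    intro c i k
    set m : ℝ := min (2 ^ (k + 1) * ψ q) ((1 / 2) ^ k) with hm
    have hm0 : 0 < m := lt_min (by positivity) (by positivity)
    have hm1 : m ≤ 1 := (min_le_right _ _).trans (pow_le_one₀ (by norm_num) (by norm_num))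
    have hm2 : m ≤ (1 / 2) ^ k := min_le_right _ _
    refine (hausdorffPre_rectangle_le ht0 ht1 c i (by positivity) (by gcongr)
      (le_trans (ENNReal.ofReal_le_ofReal ?_) hr)).trans (ENNReal.ofReal_le_ofReal ?_)
    · rw [← mul_div_assoc]
      gcongr
      linarith
    · have h1 : (m / q) ^ t ≤ (2 ^ (k + 1) * (ψ q / q)) ^ t := by
        refine Real.rpow_le_rpow (by positivity) ?_ ht0.le
        rw [← mul_div_assoc]
        gcongr
        exact min_le_left _ _
      have h2 : ((2 : ℝ) ^ (k + 1)) ^ t ≤ 2 * (2 ^ t) ^ k := by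
        rw [← Real.rpow_natCast 2 (k + 1), ← Real.rpow_natCast (2 ^ t) k,
          ← Real.rpow_mul (by norm_num), ← Real.rpow_mul (by norm_num), ← Real.rpow_one_add' (by norm_num) (by positivity)]
        refine Real.rpow_le_rpow_of_exponent_le (by norm_num) ?_
        push_cast
        nlinarith
      have h3 : β = 2 ^ t * (1 / 2) := by
        rw [hβ, Real.rpow_sub (by norm_num), Real.rpow_one]; ring
      calc 32 * ((1 / 2) ^ k / q * (m / q) ^ t)
          ≤ 32 * ((1 / 2) ^ k / q * (2 * (2 ^ t) ^ k * (ψ q / q) ^ t)) := by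
            rw [Real.mul_rpow (by positivity) (by positivity)] at h1
            gcongr
            exact h1.trans (by gcongr)
        _ = A * β ^ k := by rw [hA, h3, mul_pow]; ring
  have hgeom : ∑' k : ℕ, ENNReal.ofReal (A * β ^ k) = ENNReal.ofReal (A * (1 - β)⁻¹) := by
    rw [← ENNReal.ofReal_tsum_of_nonneg (fun k => by positivity)
      ((summable_geometric_of_lt_one hβ0.le hβ1).mul_left A), tsum_mul_left,
      tsum_geometric_of_lt_one hβ0.le hβ1]
  have hβ2 : 0 < (1 - β)⁻¹ := by rw [inv_pos]; linarith
  calc hausdorffPre (t + 1) r (approxAt ψ θ q)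
      ≤ ∑ i : Fin 2, ∑ p ∈ numerators θ q, ∑' k : ℕ, ENNReal.ofReal (A * β ^ k) := by
        refine (measure_mono (approxAt_subset ψ θ hq hψ)).trans ?_
        refine (measure_iUnion_fintype_le _ _).trans (Finset.sum_le_sum fun i _ => ?_)
        refine (measure_biUnion_finset_le _ _).trans (Finset.sum_le_sum fun p _ => ?_)
        exact (measure_iUnion_le _).trans (ENNReal.tsum_le_tsum fun k => hrect _ i k)
    _ = ENNReal.ofReal (2 * ((numerators θ q).card * (A * (1 - β)⁻¹))) := by
        rw [hgeom]
        generalize A * (1 - β)⁻¹ = B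
        rw [Finset.sum_const, Finset.sum_const, nsmul_eq_mul, nsmul_eq_mul,
          ENNReal.ofReal_mul (by norm_num), ENNReal.ofReal_mul (Nat.cast_nonneg _),
          ENNReal.ofReal_natCast]
        simp
    _ ≤ _ := by
        apply ENNReal.ofReal_le_ofReal
        calc 2 * ((numerators θ q).card * (A * (1 - β)⁻¹))
            ≤ 2 * (16 * (q : ℝ) ^ 2 * (A * (1 - β)⁻¹)) := by
              gcongr
              exact card_numerators_le θ hq
          _ = _ := by
              rw [hA, Real.div_rpow hψ.le hqR.le, Real.rpow_sub hqR, Real.rpow_one]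
              field_simp
              ring

theorem hausdorffMeasure_multApprox_eq_zero {ψ : ℕ → ℝ} (hψ : IsApproximatingFunction ψ)
    (θ : EuclideanSpace ℝ (Fin 2)) (ht0 : 0 < t) (ht1 : t < 1)
    (hconv : Summable fun q : ℕ => ((q + 1 : ℕ) : ℝ) ^ (1 - t) * ψ (q + 1) ^ t) :
    Measure.hausdorffMeasure (t + 1) (multApprox 2 ψ θ ∩ unitCube 2) = 0 := by
  refine hausdorffMeasure_eq_zero_of_pre fun r hr => ?_
  obtain ⟨Q, hQ⟩ : ∃ Q : ℕ, ∀ q ≥ Q, ENNReal.ofReal (4 / (q : ℝ)) ≤ r := by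
    have h1 : Filter.Tendsto (fun q : ℕ => ENNReal.ofReal (4 / (q : ℝ))) Filter.atTop (nhds 0) := by
      simpa using ENNReal.tendsto_ofReal (tendsto_const_div_atTop_nhds_zero_nat 4)
    exact Filter.eventually_atTop.1 (h1.eventually_le_const hr)
  have hsum : ∑' n, hausdorffPre (t + 1) r (approxAt ψ θ (n + Q + 1)) ≠ ⊤ := by
    have h2 : Summable fun n : ℕ => 2048 * (1 - 2 ^ (t - 1))⁻¹ *
        (((n + Q + 1 : ℕ) : ℝ) ^ (1 - t) * ψ (n + Q + 1) ^ t) :=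
      ((summable_nat_add_iff Q).2 hconv).mul_left _
    exact ne_top_of_le_ne_top h2.tsum_ofReal_ne_top (ENNReal.tsum_le_tsum fun n =>
      hausdorffPre_approxAt_le ht0 ht1 ψ θ (by omega) (hψ.pos _ (by omega)) (hQ _ (by omega)))
  refine measure_mono_null ?_ (measure_limsup_cofinite_eq_zero hsum)
  rintro v ⟨hv, hvc⟩
  rw [Filter.mem_limsup_iff_frequently_mem, Nat.cofinite_eq_atTop, Filter.frequently_atTop]
  intro N
  obtain ⟨q, ⟨hq, hprod⟩, hlt⟩ := hv.exists_gt (N + Q + 1)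
  have hqe : q - (Q + 1) + Q + 1 = q := by omega
  refine ⟨q - (Q + 1), by omega, ?_⟩
  rw [hqe]
  exact ⟨hvc, hprod⟩

end

end MultApprox

end

theorem theorem1 (ψ : ℕ → ℝ) (hψ : MultApprox.IsApproximatingFunction ψ)
    (θ : EuclideanSpace ℝ (Fin 2)) (s : ℝ) (hs₁ : 1 < s) (hs₂ : s < 2) :
    ((Summable fun q : ℕ => ((q + 1 : ℕ) : ℝ) ^ (2 - s) * ψ (q + 1) ^ (s - 1)) →
      Measure.hausdorffMeasure s (MultApprox.multApprox 2 ψ θ ∩ MultApprox.unitCube 2) = 0) ∧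
    ((¬ Summable fun q : ℕ => ((q + 1 : ℕ) : ℝ) ^ (2 - s) * ψ (q + 1) ^ (s - 1)) →
      Measure.hausdorffMeasure s (MultApprox.multApprox 2 ψ θ ∩ MultApprox.unitCube 2)
          = Measure.hausdorffMeasure s (MultApprox.unitCube 2) ∧
        Measure.hausdorffMeasure s (MultApprox.unitCube 2) = ⊤) := by
  obtain ⟨t, rfl⟩ : ∃ t, s = t + 1 := ⟨s - 1, by ring⟩
  have h1 : 2 - (t + 1) = 1 - t := by ring
  have h2 : t + 1 - 1 = t := by ring
  rw [h1, h2]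
  refine ⟨MultApprox.hausdorffMeasure_multApprox_eq_zero hψ θ (by linarith) (by linarith),
    fun hdiv => ?_⟩
  have htop := MultApprox.hausdorffMeasure_multApprox_eq_top hψ θ (by linarith) (by linarith) hdiv
  have hcube : Measure.hausdorffMeasure (t + 1) (MultApprox.unitCube 2) = ⊤ :=
    measure_mono_top Set.inter_subset_right htop
  exact ⟨htop.trans hcube.symm, hcube⟩
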